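/- Let $s,L,Q,\sigma>0$ and let $k$ be the largest integer with $k<s$. For $D\subseteq\mathbb R$ an interval let $\Sigma(s,L;D)$ be the set of functions $f:D\to\mathbb R$ that are $k$ times differentiable with $|f^{(k)}(x)-f^{(k)}(y)|\le L|x-y|^{s-k}$ for all $x,y\in D$, and let $\Sigma=\Sigma^Q(s,L)$ be the set of $f\in\Sigma(s,L;[0,1])$ with $\sup_{[0,1]}|f|\le Q$. For $n\ge1$ one observes $(X_i,Y_i)$, $1\le i\le n$, with $Y_i=f(X_i)+\xi_i$, where the $\xi_i$ are i.i.d. $\mathcal N(0,\sigma^2)$, independent of the $X_i$, and the $X_i$ are i.i.d. with density $\mu$ on $[0,1]$; $\mathbb E^n_{f,\mu}$ is the expectation under the joint law of the observations. Assume that $\mu\in\Sigma(\nu,\varrho;[0,1])$ for some $0<\nu\le1$, $\varrho>0$, and that $\mu(x)\ge q$ for all $x\in[0,1]$ and some $q>0$. Put $$r_{n,\mu}(x)=\Big(\frac{\log n}{n\mu(x)}\Big)^{s/(2s+1)},\qquad P=\sigma^{2s/(2s+1)}L^{1/(2s+1)}\,\varphi_s(0)\Big(\frac2{2s+1}\Big)^{s/(2s+1)},$$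 where $\varphi_s(0)$ is the maximal value of $\varphi(0)$ over all $\varphi\in\Sigma(s,1;\mathbb R)$ with $\|\varphi\|_{L^2(\mathbb R)}\le1$. Let $w:[0,\infty)\to[0,\infty)$ be a loss function, that is, a nondecreasing function with $w(x)\le A(1+x^b)$ for some $A,b>0$ (and $w(\infty):=\sup w$). Let $I_n\subset[0,1]$, $n\ge1$, be intervals with lengths $|I_n|$. (i) If $\varepsilon\in(0,1)$ and $|I_n|\,n^{\varepsilon/(2s+1)}\to+\infty$ as $n\to\infty$, then $$\liminf_n\inf_{\widehat f_n}\sup_{f\in\Sigma}\mathbb E^n_{f,\mu}\Big\{w\Big(\sup_{x\in I_n}r_{n,\mu}(x)^{-1}|\widehat f_n(x)-f(x)|\Big)\Big\}\ge w\big((1-\varepsilon)P\big),$$ where the infimum is taken over all estimators, i.e. all random functions $\widehat f_n$ on $[0,1]$ whose value at each point is a measurable function of the observations. (ii) Consequently, if $|I_n|\,n^{\varepsilon/(2s+1)}\to+\infty$ for every $\varepsilon\in(0,1)$ and $w$ is left-continuous at $P$, then $$\liminf_n\inf_{\widehat f_n}\sup_{f\in\Sigma}\mathbb E^n_{f,\mu}\Big\{w\Big(\sup_{x\in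 I_n}r_{n,\mu}(x)^{-1}|\widehat f_n(x)-f(x)|\Big)\Big\}\ge w(P).$$ -/

import Mathlib

open Set Filter MeasureTheory ProbabilityTheory
open scoped Topology ENNReal NNReal

/-- The largest integer strictly smaller than `s` (for `s > 0`). -/
noncomputable def holderOrder (s : ℝ) : ℕ := ⌈s⌉₊ - 1

/-- The Hölder ball `Σ(s, L; D)` on a set `D ⊆ ℝ`: with `k` the largest integer `< s`, the functions
that are `k` times continuously differentiable on `D` and satisfy
`|f⁽ᵏ⁾(x) - f⁽ᵏ⁾(y)| ≤ L |x - y| ^ (s - k)` for all `x, y ∈ D`. (Existence of `f⁽ᵏ⁾` and the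
inequality already force its continuity.) Functions on `D` are represented by functions on `ℝ`
whose values outside `D` play no role. -/
def holderBall (s L : ℝ) (D : Set ℝ) : Set (ℝ → ℝ) :=
  {f | ContDiffOn ℝ (holderOrder s) f D ∧ ∀ x ∈ D, ∀ y ∈ D,
    |iteratedDerivWithin (holderOrder s) f D x - iteratedDerivWithin (holderOrder s) f D y|
      ≤ L * |x - y| ^ (s - (holderOrder s : ℝ))}

/-- `Σ^Q(s, L)`: the functions of the Hölder ball on `[0, 1]` that are bounded by `Q` there. -/
def boundedHolderBall (s L Q : ℝ) : Set (ℝ → ℝ) :=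
  {f | f ∈ holderBall s L (Icc 0 1) ∧ ∀ x ∈ Icc (0 : ℝ) 1, |f x| ≤ Q}

/-- The design assumption: `μ` is a probability density on `[0, 1]`, Hölder of exponent
`ν ∈ (0, 1]`, and bounded from below by a positive constant. -/
def IsDesignDensity (μ : ℝ → ℝ) : Prop :=
  (∃ ν ϱ q : ℝ, 0 < ν ∧ ν ≤ 1 ∧ 0 < ϱ ∧ 0 < q ∧
    μ ∈ holderBall ν ϱ (Icc 0 1) ∧ ∀ x ∈ Icc (0 : ℝ) 1, q ≤ μ x) ∧
  ∫ x in Icc (0 : ℝ) 1, μ x = 1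

/-- A loss function: nonnegative, nondecreasing and of at most polynomial growth on `[0, ∞)`. -/
def IsLoss (w : ℝ → ℝ) : Prop :=
  (∀ x, 0 ≤ x → 0 ≤ w x) ∧ MonotoneOn w (Ici 0) ∧
    ∃ A b : ℝ, 0 < A ∧ 0 < b ∧ ∀ x, 0 ≤ x → w x ≤ A * (1 + x ^ b)

/-- The monotone extension of a loss function to `[0, ∞]`, with `w(∞) = sup w`; it is needed because
the supremum of an estimation error may be infinite. -/
noncomputable def extLoss (w : ℝ → ℝ) (u : ℝ≥0∞) : ℝ≥0∞ :=
  ⨆ (t : ℝ≥0) (_ : (t : ℝ≥0∞) ≤ u), ENNReal.ofReal (w t)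

theorem extLoss_coe {w : ℝ → ℝ} (hw : IsLoss w) (u : ℝ≥0) :
    extLoss w u = ENNReal.ofReal (w u) := by
  apply le_antisymm
  · refine iSup₂_le fun t ht => ENNReal.ofReal_le_ofReal ?_
    exact hw.2.1 t.2 u.2 (by exact_mod_cast ht)
  · exact le_iSup₂_of_le u le_rfl le_rfl

/-- The law of one observation `(X, Y)`, `Y = f(X) + ξ`, where `X` has density `μ` on `[0, 1]` and
`ξ` is centered Gaussian with variance `σ²`, independent of `X`. -/
noncomputable def obsLaw (μ f : ℝ → ℝ) (σ : ℝ) : Measure (ℝ × ℝ) :=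
  (((volume.restrict (Icc (0 : ℝ) 1)).withDensity fun x => ENNReal.ofReal (μ x)).prod
    (gaussianReal 0 (σ ^ 2).toNNReal)).map fun p => (p.1, f p.1 + p.2)

/-- The joint law of `n` independent observations. -/
noncomputable def sampleLaw (μ f : ℝ → ℝ) (σ : ℝ) (n : ℕ) : Measure (Fin n → ℝ × ℝ) :=
  Measure.pi fun _ => obsLaw μ f σ

/-- Estimators from `n` observations: maps from the data to functions whose value at each point of
`[0, 1]` is a measurable function of the data. -/
def estimators (n : ℕ) : Set ((Fin n → ℝ × ℝ) → ℝ → ℝ) :=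
  {T | ∀ x ∈ Icc (0 : ℝ) 1, Measurable fun d => T d x}

/-- The spatially dependent rate `r_{n,μ}(x) = (log n / (n μ(x))) ^ (s / (2 s + 1))`. -/
noncomputable def rate (s : ℝ) (μ : ℝ → ℝ) (n : ℕ) (x : ℝ) : ℝ :=
  (Real.log n / (n * μ x)) ^ (s / (2 * s + 1))

/-- The normalised error `sup_{x ∈ I} r_{n,μ}(x)⁻¹ |g(x) - f(x)|`, in `[0, ∞]`. -/
noncomputable def normError (s : ℝ) (μ : ℝ → ℝ) (n : ℕ) (I : Set ℝ) (g f : ℝ → ℝ) : ℝ≥0∞ :=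
  ⨆ x ∈ I, ENNReal.ofReal ((rate s μ n x)⁻¹ * |g x - f x|)

/-- The minimax risk over `Σ^Q(s, L)`, i.e. the infimum over all estimators of the supremum over
`f` of the expected loss of the normalised error on `I`. When the supremum over the uncountable set
`I` is not measurable, `∫⁻` is the lower integral, the smallest reading of the expectation. -/
noncomputable def supMinimaxRisk (s L Q σ : ℝ) (μ w : ℝ → ℝ) (n : ℕ) (I : Set ℝ) : ℝ≥0∞ :=
  ⨅ T ∈ estimators n, ⨆ f ∈ boundedHolderBall s L Q,
    ∫⁻ d, extLoss w (normError s μ n I (T d) f) ∂(sampleLaw μ f σ n)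

/-- The admissible functions of the optimal recovery problem: `φ ∈ Σ(s, 1; ℝ)`, `‖φ‖₂ ≤ 1`. -/
def recoveryClass (s : ℝ) : Set (ℝ → ℝ) :=
  {φ | φ ∈ holderBall s 1 univ ∧ eLpNorm φ 2 volume ≤ 1}

/-- The optimal value `φ_s(0) = max {φ(0) : φ ∈ Σ(s, 1; ℝ), ‖φ‖₂ ≤ 1}`. The set is bounded above
(`bddAbove_recovery`), and the value is attained at every solution of the
optimisation problem (`eq_recoveryValue`). -/
noncomputable def recoveryValue (s : ℝ) : ℝ := sSup ((fun φ : ℝ → ℝ => φ 0) '' recoveryClass s)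

theorem eq_recoveryValue {s : ℝ} {φ : ℝ → ℝ} (hφ : φ ∈ recoveryClass s)
    (hmax : IsMaxOn (fun ψ : ℝ → ℝ => ψ 0) (recoveryClass s) φ) : φ 0 = recoveryValue s := by
  have hg : IsGreatest ((fun ψ : ℝ → ℝ => ψ 0) '' recoveryClass s) (φ 0) := by
    refine ⟨mem_image_of_mem (fun ψ : ℝ → ℝ => ψ 0) hφ, ?_⟩
    rintro _ ⟨ψ, hψ, rfl⟩
    exact hmax hψ
  exact hg.csSup_eq.symm

/-- Iterated differences of order `k + 1` are bounded by `1` for steps in `[0, 1]`. -/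
theorem abs_fwdDiff_le {a h : ℝ} (ha : 0 ≤ a) (h0 : 0 ≤ h) (h1 : h ≤ 1) (k : ℕ) :
    ∀ g : ℝ → ℝ, ContDiff ℝ k g →
      (∀ x y, |iteratedDeriv k g x - iteratedDeriv k g y| ≤ |x - y| ^ a) →
      ∀ x, |(fwdDiff h)^[k + 1] g x| ≤ 1 := by
  have hd : ∀ m : ℕ, ∀ g : ℝ → ℝ, Differentiable ℝ g →
      ∀ x, HasDerivAt ((fwdDiff h)^[m] g) ((fwdDiff h)^[m] (deriv g) x) x := by
    intro m
    induction m with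
    | zero => intro g hg x; exact (hg x).hasDerivAt
    | succ m ih =>
      intro g hg x
      rw [Function.iterate_succ_apply', Function.iterate_succ_apply']
      exact ((ih g hg (x + h)).comp_add_const x h).sub (ih g hg x)
  induction k with
  | zero =>
    intro g _ hb x
    have := hb (x + h) x
    simp only [iteratedDeriv_zero, add_sub_cancel_left, abs_of_nonneg h0] at this
    simpa [fwdDiff] using this.trans (Real.rpow_le_one h0 h1 ha)
  | succ k ih =>
    intro g hg hb x
    have hg1 : Differentiable ℝ g := hg.differentiable (by simp)
    have hg2 : ContDiff ℝ k (deriv g) := by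
      have := (contDiff_succ_iff_deriv (n := (k : WithTop ℕ∞)) (f := g) (𝕜 := ℝ)).1
        (by exact_mod_cast hg)
      exact this.2.2
    have hbd := ih (deriv g) hg2 (by simpa only [iteratedDeriv_succ'] using hb)
    rw [Function.iterate_succ_apply']
    have := convex_univ.norm_image_sub_le_of_norm_hasDerivWithin_le (C := 1)
      (f := (fwdDiff h)^[k + 1] g) (f' := (fwdDiff h)^[k + 1] (deriv g))
      (fun y _ => (hd (k + 1) g hg1 y).hasDerivWithinAt)
      (fun y _ => hbd y) (mem_univ x) (mem_univ (x + h))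
    have h3 : ‖x + h - x‖ = h := by rw [add_sub_cancel_left, Real.norm_of_nonneg h0]
    rw [h3, Real.norm_eq_abs] at this
    exact this.trans (by linarith)

theorem bddAbove_recovery {s : ℝ} (hs : 0 < s) :
    BddAbove ((fun φ : ℝ → ℝ => φ 0) '' recoveryClass s) := by
  set k := holderOrder s with hk
  have hks : 0 ≤ s - (k : ℝ) := by
    have h1 : 1 ≤ ⌈s⌉₊ := Nat.one_le_ceil_iff.2 hs
    have h2 := Nat.ceil_lt_add_one hs.le
    have h3 : ((k : ℕ) : ℝ) = (⌈s⌉₊ : ℝ) - 1 := by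
      rw [hk, holderOrder, Nat.cast_sub h1]; simp
    rw [h3]; linarith
  refine ⟨1 + ∑ j ∈ Finset.range (k + 1), ((k + 1).choose (j + 1) : ℝ) * 2, ?_⟩
  rintro _ ⟨φ, ⟨⟨hφ1, hφ2⟩, hφ3⟩, rfl⟩
  simp only [iteratedDerivWithin_univ, contDiffOn_univ, mem_univ, true_imp_iff, one_mul] at hφ1 hφ2
  have hc : Continuous φ := hφ1.continuous
  have hL2 : MemLp φ 2 volume := ⟨hc.aestronglyMeasurable, hφ3.trans_lt ENNReal.one_lt_top⟩
  have hint : Integrable (fun x => φ x ^ 2) := hL2.integrable_sq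
  have hle : ∫ x, φ x ^ 2 ≤ 1 := by
    have h1 := hL2.eLpNorm_eq_integral_rpow_norm (by simp) (by simp)
    rw [h1, ENNReal.ofReal_le_one] at hφ3
    simp only [ENNReal.toReal_ofNat, Real.rpow_two, Real.norm_eq_abs, sq_abs] at hφ3
    have h2 : 0 ≤ ∫ x, φ x ^ 2 := integral_nonneg fun x => sq_nonneg _
    by_contra! hlt
    exact absurd hφ3 (not_le.2 (Real.one_lt_rpow hlt (by norm_num)))
  have hpt : ∀ h ∈ Icc (0 : ℝ) 1, φ 0 ≤ 1 + ∑ j ∈ Finset.range (k + 1),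
      ((k + 1).choose (j + 1) : ℝ) * (1 + φ (((j : ℝ) + 1) * h) ^ 2) := by
    intro h hh
    have hb := abs_fwdDiff_le hks hh.1 hh.2 k φ hφ1 hφ2 0
    rw [fwdDiff_iter_eq_sum_shift, Finset.sum_range_succ'] at hb
    simp only [zero_add, zero_smul, Nat.choose_zero_right] at hb
    set S := ∑ j ∈ Finset.range (k + 1),
      ((-1 : ℤ) ^ (k + 1 - (j + 1)) * ((k + 1).choose (j + 1) : ℤ)) • φ ((j + 1) • h) with hS
    have hSb : |S| ≤ ∑ j ∈ Finset.range (k + 1),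
        ((k + 1).choose (j + 1) : ℝ) * (1 + φ (((j : ℝ) + 1) * h) ^ 2) := by
      refine (Finset.abs_sum_le_sum_abs _ _).trans (Finset.sum_le_sum fun j _ => ?_)
      rw [zsmul_eq_mul, abs_mul, nsmul_eq_mul]
      push_cast
      rw [abs_mul, abs_pow, abs_neg, abs_one, one_pow, one_mul, Nat.abs_cast]
      gcongr
      rw [← sq_abs]
      nlinarith [sq_nonneg (|φ (((j : ℝ) + 1) * h)| - 1), abs_nonneg (φ (((j : ℝ) + 1) * h))]
    set c : ℤ := (-1 : ℤ) ^ (k + 1 - 0) * ((1 : ℕ) : ℤ) with hcc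
    have hcabs : |(c • φ 0 : ℝ)| = |φ 0| := by
      rw [zsmul_eq_mul, abs_mul, hcc]
      push_cast
      rw [abs_mul, abs_pow, abs_neg, abs_one, one_pow, one_mul, one_mul]
    have h1 : |φ 0| ≤ |S + c • φ 0| + |S| := by
      rw [← hcabs]
      have := abs_sub (S + c • φ 0) S
      rwa [add_sub_cancel_left] at this
    have := le_abs_self (φ 0)
    linarith
  have hii : ∀ j : ℕ, IntervalIntegrable (fun h : ℝ => φ (((j : ℝ) + 1) * h) ^ 2) volume 0 1 :=
    fun j => Continuous.intervalIntegrable (by fun_prop) _ _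
  have hmono := intervalIntegral.integral_mono_on (μ := volume) (a := 0) (b := 1)
    (f := fun _ : ℝ => φ 0)
    (g := fun h => 1 + ∑ j ∈ Finset.range (k + 1),
      ((k + 1).choose (j + 1) : ℝ) * (1 + φ (((j : ℝ) + 1) * h) ^ 2)) zero_le_one
    (by simp) (Continuous.intervalIntegrable (by fun_prop) _ _) hpt
  refine le_trans (le_of_eq (by simp)) (hmono.trans ?_)
  rw [intervalIntegral.integral_add (by simp)
    (Continuous.intervalIntegrable (by fun_prop) _ _),
    intervalIntegral.integral_finsetSum
      (fun j _ => Continuous.intervalIntegrable (by fun_prop) _ _)]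
  simp only [intervalIntegral.integral_const, sub_zero, one_smul]
  gcongr with j hj
  rw [intervalIntegral.integral_const_mul, intervalIntegral.integral_add (by simp) (hii j)]
  gcongr
  rw [intervalIntegral.integral_comp_mul_left (fun x => φ x ^ 2) (by positivity)]
  simp only [intervalIntegral.integral_const, sub_zero, mul_zero, mul_one, smul_eq_mul]
  have hj0 : (0 : ℝ) ≤ (j : ℝ) + 1 := by positivity
  have hA : ∫ x in (0 : ℝ)..((j : ℝ) + 1), φ x ^ 2 ≤ 1 := by
    rw [intervalIntegral.integral_of_le hj0]
    exact (setIntegral_le_integral hint (ae_of_all _ fun x => sq_nonneg _)).trans hle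
  have hB : ((j : ℝ) + 1)⁻¹ ≤ 1 := inv_le_one_of_one_le₀ (by linarith [j.cast_nonneg (α := ℝ)])
  have hA0 : 0 ≤ ∫ x in (0 : ℝ)..((j : ℝ) + 1), φ x ^ 2 :=
    intervalIntegral.integral_nonneg hj0 fun x _ => sq_nonneg _
  have := mul_le_one₀ hB hA0 hA
  linarith

/-- The constant
`P = σ ^ (2 s / (2 s + 1)) L ^ (1 / (2 s + 1)) φ_s(0) (2 / (2 s + 1)) ^ (s / (2 s + 1))`. -/
noncomputable def minimaxConst (s L σ : ℝ) : ℝ :=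
  σ ^ (2 * s / (2 * s + 1)) * L ^ (1 / (2 * s + 1)) * recoveryValue s *
    (2 / (2 * s + 1)) ^ (s / (2 * s + 1))

/-! The bound is a Bayes argument over sign vectors. Place `M` bumps `u j = L h ^ s φ((· - x j) /
h)` at separated points of `I n` and let `f` be their superposition with arbitrary signs. An
estimator whose error at every `x j` is smaller than `u j (x j)` has guessed every sign; otherwise
its normalised error is at least `t`, provided each height is at least `t` times the rate at `x j`.
So the risk is at least `w t` times the probability of not guessing all signs, averaged over uniform
signs (`ofReal_loss_le_supMinimaxRisk_add`).

Given the design, disjointness of the supports splits the problem into `M` independent Gaussian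
tests with information `V j = ∑ i, u j (X i) ^ 2 / σ ^ 2`. A single sign is missed with probability
at least about `exp (-V j / 2)`, up to `1 + λ` in the exponent and a constant factor
(`integral_half_exp_abs_le`). Hence all signs are guessed with probability at most `∏ j, (1 - exp
(-κ V j - b) / 2)`. Only the mean of the `V j` matters by Jensen, and its upper deviations are
controlled by an exponential moment of the design (`lintegral_prod_one_sub_exp_le`).

The constant comes from the following count. With `p = 1 / (2 s + 1)`, the local bandwidth `(c log n
/ (n μ (x j))) ^ p` makes the height `L c ^ (s p) φ(0)` times the rate and the mean information at
most about `L² c log n / σ²`, since `‖φ‖₂ ≤ 1`. There is room for about `|I n| n ^ p` bumps up to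
logarithms, which is at least of order `n ^ (p (1 - ε))`. The choice `L² c / σ² = 2 p (1 - ε)²`
makes a single error about `n ^ (-p (1 - ε)²)` probable. As `(1 - ε)² < 1 - ε`, many errors are
expected and the probability of guessing all signs tends to `0`.

The height is then `(1 - ε) P` if `φ` is nearly extremal for the recovery problem. Mollification and
truncation give such a `φ` that is smooth with compact support (`exists_smooth_near_recoveryValue`),
and wide enough gaps keep the Hölder constant of every signed sum equal to `L`
(`exists_separatesBumps`). -/

/-! ### Product measures -/

/-- Functions of disjoint blocks of coordinates are independent under a product measure. -/
theorem indepFun_pi_of_dependsOn {ι E β β' : Type*} [Fintype ι] [MeasurableSpace E] [Inhabited E]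
    [MeasurableSpace β] [MeasurableSpace β']
    (m : ι → Measure E) [∀ i, IsProbabilityMeasure (m i)] {F : (ι → E) → β} {G : (ι → E) → β'}
    (hF : Measurable F) (hG : Measurable G) {S T : Finset ι} (hST : Disjoint S T)
    (hFS : DependsOn F S) (hGT : DependsOn G T) : IndepFun F G (Measure.pi m) := by
  classical
  have hi : iIndepFun (fun (i : ι) (ω : ι → E) => ω i) (Measure.pi m) :=
    iIndepFun_pi (X := fun _ x => x) fun i => aemeasurable_id
  have h := hi.indepFun_finset S T hST fun i => measurable_pi_apply i
  have hext : ∀ U : Finset ι,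
      Measurable fun (z : U → E) (i : ι) => if hi : i ∈ U then z ⟨i, hi⟩ else default := by
    intro U
    refine measurable_pi_lambda _ fun i => ?_
    by_cases hi : i ∈ U
    · simpa [hi] using measurable_pi_apply _
    · simp [hi]
  have h2 := h.comp (hF.comp (hext S)) (hG.comp (hext T))
  convert h2 using 1
  · ext ω
    exact hFS fun i hi => by simp [Finset.mem_coe.1 hi]
  · ext ω
    exact hGT fun i hi => by simp [Finset.mem_coe.1 hi]

/-- Each design point lies in at most one bump, so the test statistics of different bumps read
disjoint sets of noise variables. This is the source of their conditional independence. -/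
theorem lintegral_pi_prod_of_dependsOn {ι κ E : Type*} [Fintype ι] [MeasurableSpace E] [Inhabited E]
    (m : ι → Measure E) [∀ i, IsProbabilityMeasure (m i)] {F : κ → (ι → E) → ℝ≥0∞}
    (hF : ∀ j, Measurable (F j)) {S : κ → Finset ι} (hS : Pairwise fun i j => Disjoint (S i) (S j))
    (hFS : ∀ j, DependsOn (F j) (S j)) (s : Finset κ) :
    ∫⁻ ω, ∏ j ∈ s, F j ω ∂(Measure.pi m) = ∏ j ∈ s, ∫⁻ ω, F j ω ∂(Measure.pi m) := by
  classical
  induction s using Finset.induction_on with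
  | empty => simp
  | insert j s hj ih =>
    simp only [Finset.prod_insert hj]
    rw [← ih]
    refine lintegral_mul_eq_lintegral_mul_lintegral_of_indepFun (hF j)
      (Finset.measurable_fun_prod s fun i _ => hF i) ?_
    refine indepFun_pi_of_dependsOn m (hF j) (Finset.measurable_fun_prod s fun i _ => hF i)
      (S := S j) (T := s.biUnion S) ?_ (hFS j) ?_
    · rw [Finset.disjoint_biUnion_right]
      exact fun i hi => hS fun h => hj (h ▸ hi)
    · intro x y hxy
      exact Finset.prod_congr rfl fun i hi => hFS i fun l hl =>
        hxy l (Finset.mem_coe.2 (Finset.mem_biUnion.2 ⟨i, hi, hl⟩))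

theorem lintegral_pi_prod_eval {ι E : Type*} [Fintype ι] [MeasurableSpace E]
    (m : ι → Measure E) [∀ i, IsProbabilityMeasure (m i)] {F : ι → E → ℝ≥0∞}
    (hF : ∀ i, Measurable (F i)) :
    ∫⁻ ω, ∏ i, F i (ω i) ∂(Measure.pi m) = ∏ i, ∫⁻ x, F i x ∂(m i) := by
  rw [lintegral_prod_eq_prod_lintegral_of_indepFun Finset.univ (fun i (ω : ι → E) => F i (ω i))
    (iIndepFun_pi fun i => (hF i).aemeasurable) fun i => (hF i).comp (measurable_pi_apply i)]
  refine Finset.prod_congr rfl fun i _ => ?_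
  exact (measurePreserving_eval m i).lintegral_comp (hF i)

theorem pi_withDensity {ι E : Type*} [Fintype ι] [MeasurableSpace E]
    (m : Measure E) [IsProbabilityMeasure m] {ℓ : E → ℝ≥0∞} (hℓ : Measurable ℓ)
    [SigmaFinite (m.withDensity ℓ)] :
    Measure.pi (fun _ : ι => m.withDensity ℓ) =
      (Measure.pi fun _ : ι => m).withDensity fun ω => ∏ i, ℓ (ω i) := by
  refine Measure.pi_eq fun s hs => ?_
  have hmeas : MeasurableSet (univ.pi s) := MeasurableSet.univ_pi hs
  rw [withDensity_apply _ hmeas, ← lintegral_indicator hmeas]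
  have : ∀ ω : ι → E, (univ.pi s).indicator (fun ω => ∏ i, ℓ (ω i)) ω =
      ∏ i, (s i).indicator ℓ (ω i) := by
    intro ω
    by_cases h : ω ∈ univ.pi s
    · rw [indicator_of_mem h]
      exact Finset.prod_congr rfl fun i _ => (indicator_of_mem (h i trivial) _).symm
    · rw [indicator_of_notMem h]
      simp only [mem_univ_pi, not_forall] at h
      obtain ⟨i, hi⟩ := h
      exact (Finset.prod_eq_zero (Finset.mem_univ i) (indicator_of_notMem hi _)).symm
  simp_rw [this]
  rw [lintegral_pi_prod_eval _ fun i => hℓ.indicator (hs i)]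
  exact Finset.prod_congr rfl fun i _ => by
    rw [lintegral_indicator (hs i), withDensity_apply _ (hs i)]

/-! ### Gaussian likelihood ratios and moments -/

/-- The exponential is the likelihood ratio of `𝒩(a, v)` to `𝒩(0, v)`. It lets all hypotheses be
compared under the law of pure noise. -/
theorem lintegral_gaussianReal_const_add {v : ℝ≥0} (hv : v ≠ 0) (a : ℝ) {F : ℝ → ℝ≥0∞}
    (hF : Measurable F) :
    ∫⁻ y, F (a + y) ∂(gaussianReal 0 v) =
      ∫⁻ y, ENNReal.ofReal (Real.exp ((a * y - a ^ 2 / 2) / v)) * F y ∂(gaussianReal 0 v) := by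
  have h1 : ∫⁻ y, F (a + y) ∂(gaussianReal 0 v) = ∫⁻ y, F y ∂(gaussianReal a v) := by
    have := gaussianReal_map_const_add (μ := 0) (v := v) a
    rw [zero_add] at this
    rw [← this, lintegral_map hF (by fun_prop)]
  rw [h1, gaussianReal_of_var_ne_zero _ hv, gaussianReal_of_var_ne_zero _ hv,
    lintegral_withDensity_eq_lintegral_mul _ (measurable_gaussianPDF _ _) hF,
    lintegral_withDensity_eq_lintegral_mul _ (measurable_gaussianPDF _ _) (by fun_prop)]
  refine lintegral_congr fun y => ?_
  simp only [Pi.mul_apply]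
  rw [← mul_assoc]
  congr 1
  rw [gaussianPDF, gaussianPDF, ← ENNReal.ofReal_mul (gaussianPDFReal_nonneg _ _ _)]
  congr 1
  rw [gaussianPDFReal, gaussianPDFReal, mul_assoc _ (Real.exp _) (Real.exp _), ← Real.exp_add]
  congr 2
  have : (v : ℝ) ≠ 0 := by exact_mod_cast hv
  field_simp
  ring

/-- Exponential moments of a linear functional of a Gaussian sample. -/
theorem integral_exp_sum_gaussian {n : ℕ} (v : ℝ≥0) (a : Fin n → ℝ) :
    ∫ y, Real.exp (∑ i, a i * y i) ∂(Measure.pi fun _ : Fin n => gaussianReal 0 v) =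
      Real.exp (v * (∑ i, a i ^ 2) / 2) := by
  simp_rw [Real.exp_sum]
  rw [integral_fintype_prod_eq_prod (fun i y => Real.exp (a i * y))]
  have : ∀ i, ∫ y, Real.exp (a i * y) ∂(gaussianReal 0 v) = Real.exp (v * a i ^ 2 / 2) := by
    intro i
    have := congrFun (mgf_fun_id_gaussianReal (μ := 0) (v := v)) (a i)
    simpa [mgf] using this
  simp_rw [this]
  rw [← Real.exp_sum, Finset.mul_sum, Finset.sum_div]

theorem integrable_exp_sum_gaussian {n : ℕ} (v : ℝ≥0) (a : Fin n → ℝ) :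
    Integrable (fun y => Real.exp (∑ i, a i * y i))
      (Measure.pi fun _ : Fin n => gaussianReal 0 v) := by
  simp_rw [Real.exp_sum]
  exact Integrable.fintype_prod (f := fun i y => Real.exp (a i * y))
    fun i => integrable_exp_mul_gaussianReal _

/-- If `Z` has the exponential moments of `𝒩(0, V)`, the better of the two likelihood ratios of
`±1` signals has mean bounded away from its maximal value `1`. -/
theorem integral_half_exp_abs_le {Ω : Type*} [MeasurableSpace Ω] {P : Measure Ω}
    [IsProbabilityMeasure P] {Z : Ω → ℝ} {V : ℝ}
    (hint : ∀ t : ℝ, Integrable (fun ω => Real.exp (t * Z ω)) P)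
    (hmgf : ∀ t : ℝ, ∫ ω, Real.exp (t * Z ω) ∂P = Real.exp (t ^ 2 * V / 2)) {lam : ℝ}
    (hlam : 0 < lam) :
    ∫⁻ ω, ENNReal.ofReal (Real.exp (|Z ω| - V / 2) / 2) ∂P ≤
      ENNReal.ofReal (1 - Real.exp (-((1 + lam) * V / 2) - Real.log 2 / lam) / 2) := by
  -- Since `e^|Z| = e^Z + e^(-Z) - e^(-|Z|)`, the gap to `1` is `e^(-V/2) E e^(-|Z|) / 2`. The
  -- tangent at `c` bounds `e^(-|Z|)` below by `e^(-c) (1 + c - |Z|)`. As `e^b` is the mean of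
  -- `e^(λZ) + e^(-λZ)`, the inequality `λ|Z| ≤ e^(λ|Z| - b) - 1 + b` gives `E |Z| ≤ b / λ = c`. The
  -- majorant `B` collects these bounds using exponentials of multiples of `Z` only, so its mean is
  -- explicit.
  set b := Real.log 2 + lam ^ 2 * V / 2 with hb
  set c := b / lam with hc
  set B : Ω → ℝ := fun ω => Real.exp (-(V / 2)) *
    ((Real.exp (1 * Z ω) + Real.exp (-1 * Z ω)) / 2 - Real.exp (-c) / 2 *
      (1 + c - ((Real.exp (lam * Z ω) + Real.exp (-lam * Z ω)) * Real.exp (-b) - 1 + b) / lam))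
    with hB
  have key : ∀ ω, Real.exp (|Z ω| - V / 2) / 2 ≤ B ω := by
    intro ω
    have e1 : Real.exp |Z ω| + Real.exp (-|Z ω|) = Real.exp (1 * Z ω) + Real.exp (-1 * Z ω) := by
      rcases abs_cases (Z ω) with ⟨h, _⟩ | ⟨h, _⟩ <;> rw [h] <;> simp [add_comm]
    have e2 : Real.exp (lam * |Z ω|) ≤ Real.exp (lam * Z ω) + Real.exp (-lam * Z ω) := by
      rcases abs_cases (Z ω) with ⟨h, _⟩ | ⟨h, _⟩ <;> rw [h]
      · linarith [Real.exp_pos (-lam * Z ω)]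
      · have : lam * -Z ω = -lam * Z ω := by ring
        rw [this]; linarith [Real.exp_pos (lam * Z ω)]
    have e3 : lam * |Z ω| - b + 1 ≤ Real.exp (lam * |Z ω|) * Real.exp (-b) := by
      rw [← Real.exp_add]; linarith [Real.add_one_le_exp (lam * |Z ω| + -b)]
    have e4 : |Z ω| ≤
        ((Real.exp (lam * Z ω) + Real.exp (-lam * Z ω)) * Real.exp (-b) - 1 + b) / lam := by
      rw [le_div_iff₀ hlam]
      nlinarith [Real.exp_pos (-b)]
    have e5 : Real.exp (-c) * (1 + c - |Z ω|) ≤ Real.exp (-|Z ω|) := by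
      have := Real.add_one_le_exp (c - |Z ω|)
      have h2 : Real.exp (-|Z ω|) = Real.exp (-c) * Real.exp (c - |Z ω|) := by
        rw [← Real.exp_add]; ring_nf
      rw [h2]
      exact mul_le_mul_of_nonneg_left (by linarith) (Real.exp_pos _).le
    have e6 : Real.exp (|Z ω| - V / 2) = Real.exp (-(V / 2)) * Real.exp |Z ω| := by
      rw [← Real.exp_add]; ring_nf
    rw [e6, hB, mul_div_assoc]
    refine mul_le_mul_of_nonneg_left ?_ (Real.exp_pos _).le
    rw [← e1]
    have e7 := mul_le_mul_of_nonneg_left (sub_le_sub_left e4 (1 + c)) (Real.exp_pos (-c)).le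
    linarith
  have hsum : ∀ t : ℝ, Integrable (fun ω => Real.exp (t * Z ω) + Real.exp (-t * Z ω)) P :=
    fun t => (hint t).add (hint (-t))
  have hlin : B = fun ω => Real.exp (-(V / 2)) / 2 * (Real.exp (1 * Z ω) + Real.exp (-1 * Z ω)) +
      Real.exp (-(V / 2)) * Real.exp (-c) / 2 * Real.exp (-b) / lam *
        (Real.exp (lam * Z ω) + Real.exp (-lam * Z ω)) +
      -(Real.exp (-(V / 2)) * Real.exp (-c) / 2 * (1 + c - (-1 + b) / lam)) := by
    ext ω; rw [hB]; ring
  have hi1 := (hsum 1).const_mul (Real.exp (-(V / 2)) / 2)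
  have hi2 := (hsum lam).const_mul (Real.exp (-(V / 2)) * Real.exp (-c) / 2 * Real.exp (-b) / lam)
  have hi12 := hi1.add hi2
  have hBi : Integrable B P := hlin ▸ hi12.add (integrable_const _)
  have hBe : ∫ ω, B ω ∂P = 1 - Real.exp (-((1 + lam) * V / 2) - Real.log 2 / lam) / 2 := by
    rw [hlin]
    refine (integral_add hi12 (integrable_const _)).trans ?_
    rw [integral_add' hi1 hi2, integral_const_mul,
      integral_const_mul, integral_add (hint 1) (hint (-1)), integral_add (hint lam) (hint (-lam))]
    simp only [hmgf, integral_const, probReal_univ, one_smul]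
    have h5 : Real.exp (lam ^ 2 * V / 2) = Real.exp b / 2 := by
      rw [hb, Real.exp_add, Real.exp_log two_pos]; ring
    have h6 : Real.exp (-b) = (Real.exp b)⁻¹ := Real.exp_neg b
    have h7 : Real.exp (-(V / 2)) * Real.exp (1 ^ 2 * V / 2) = 1 := by
      rw [← Real.exp_add]; simp
    have h8 : Real.exp (-((1 + lam) * V / 2) - Real.log 2 / lam) =
        Real.exp (-(V / 2)) * Real.exp (-c) := by
      rw [← Real.exp_add, hc, hb]; congr 1; field_simp; ring
    rw [h8, neg_sq, neg_sq, h5, h6]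
    have h9 : (Real.exp b)⁻¹ * (Real.exp b / 2 + Real.exp b / 2) = 1 := by
      rw [add_halves, inv_mul_cancel₀ (Real.exp_pos b).ne']
    have h10 : c - b / lam = 0 := by rw [hc]; ring
    linear_combination h7 + Real.exp (-(V / 2)) * Real.exp (-c) / 2 / lam * h9 -
      Real.exp (-(V / 2)) * Real.exp (-c) / 2 * h10
  rw [← hBe, ofReal_integral_eq_lintegral_ofReal hBi
    (ae_of_all _ fun ω => (by positivity : (0 : ℝ) ≤ _).trans (key ω))]
  exact lintegral_mono fun ω => ENNReal.ofReal_le_ofReal (key ω)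

/-! ### The Bayes risk of sign vectors -/

/-- The law of a design point. -/
noncomputable def designLaw (μ : ℝ → ℝ) : Measure ℝ :=
  (volume.restrict (Icc (0 : ℝ) 1)).withDensity fun x => ENNReal.ofReal (μ x)

/-- The sign encoded by a Boolean. -/
def boolSign (b : Bool) : ℝ := if b then 1 else -1

theorem boolSign_sq (b : Bool) : boolSign b ^ 2 = 1 := by cases b <;> simp [boolSign]

theorem abs_boolSign (b : Bool) : |boolSign b| = 1 := by cases b <;> simp [boolSign]

theorem boolSign_mul_le (b : Bool) (z : ℝ) : boolSign b * z ≤ |z| := by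
  cases b
  · simpa [boolSign] using neg_le_abs z
  · simpa [boolSign] using le_abs_self z

theorem obsLaw_eq_withDensity (μ : ℝ → ℝ) {f : ℝ → ℝ} (hf : Measurable f) {σ : ℝ} (hσ : 0 < σ) :
    obsLaw μ f σ = ((designLaw μ).prod (gaussianReal 0 (σ ^ 2).toNNReal)).withDensity
      fun p => ENNReal.ofReal (Real.exp ((f p.1 * p.2 - f p.1 ^ 2 / 2) / σ ^ 2)) := by
  have hv : (σ ^ 2).toNNReal ≠ 0 := by simp [hσ.ne']
  have hvc : ((σ ^ 2).toNNReal : ℝ) = σ ^ 2 := Real.coe_toNNReal _ (sq_nonneg σ)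
  have hm : Measurable fun p : ℝ × ℝ => (p.1, f p.1 + p.2) := by fun_prop
  have hd : Measurable fun p : ℝ × ℝ =>
      ENNReal.ofReal (Real.exp ((f p.1 * p.2 - f p.1 ^ 2 / 2) / σ ^ 2)) := by fun_prop
  refine Measure.ext_of_lintegral _ fun F hF => ?_
  rw [lintegral_withDensity_eq_lintegral_mul _ hd hF, obsLaw, lintegral_map hF hm]
  change ∫⁻ a, F (a.1, f a.1 + a.2) ∂((designLaw μ).prod _) = _
  have : SFinite (designLaw μ) := by unfold designLaw; infer_instance
  rw [lintegral_prod (fun a : ℝ × ℝ => F (a.1, f a.1 + a.2)) (hF.comp hm).aemeasurable,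
    lintegral_prod _ (hd.mul hF).aemeasurable]
  refine lintegral_congr fun x => ?_
  have := lintegral_gaussianReal_const_add hv (f x) (F := fun y => F (x, y)) (by fun_prop)
  rw [hvc] at this
  exact this

theorem sampleLaw_eq_withDensity (μ : ℝ → ℝ) [IsProbabilityMeasure (designLaw μ)] {f : ℝ → ℝ}
    (hf : Measurable f) {σ : ℝ} (hσ : 0 < σ) (n : ℕ) :
    sampleLaw μ f σ n = (Measure.pi fun _ : Fin n =>
      (designLaw μ).prod (gaussianReal 0 (σ ^ 2).toNNReal)).withDensity
        fun d => ∏ i, ENNReal.ofReal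
          (Real.exp ((f (d i).1 * (d i).2 - f (d i).1 ^ 2 / 2) / σ ^ 2)) := by
  have h := obsLaw_eq_withDensity μ hf hσ
  have : SigmaFinite (((designLaw μ).prod (gaussianReal 0 (σ ^ 2).toNNReal)).withDensity
      fun p => ENNReal.ofReal (Real.exp ((f p.1 * p.2 - f p.1 ^ 2 / 2) / σ ^ 2))) :=
    SigmaFinite.withDensity_ofReal _
  rw [sampleLaw, h, pi_withDensity _ (by fun_prop)]

theorem isProbabilityMeasure_sampleLaw (μ : ℝ → ℝ) [IsProbabilityMeasure (designLaw μ)] {f : ℝ → ℝ}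
    (hf : Measurable f) (σ : ℝ) (n : ℕ) : IsProbabilityMeasure (sampleLaw μ f σ n) := by
  have : IsProbabilityMeasure (obsLaw μ f σ) := by
    have hm : Measurable fun p : ℝ × ℝ => (p.1, f p.1 + p.2) := by fun_prop
    exact Measure.isProbabilityMeasure_map
      (μ := (designLaw μ).prod (gaussianReal 0 (σ ^ 2).toNNReal)) hm.aemeasurable
  unfold sampleLaw
  infer_instance

theorem sum_sq_eq_of_mul_eq_zero {κ : Type*} [Fintype κ] {a : κ → ℝ}
    (ha : ∀ i j, i ≠ j → a i * a j = 0) : (∑ j, a j) ^ 2 = ∑ j, a j ^ 2 := by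
  rw [sq, Finset.sum_mul_sum]
  refine Finset.sum_congr rfl fun i _ => ?_
  rw [Finset.sum_eq_single i (fun j _ hj => ha i j hj.symm) (by simp), sq]

/-- The likelihood of a sum of disjoint signals factorises. -/
theorem prod_likelihood_eq {n M : ℕ} {σ : ℝ} {u : Fin M → ℝ → ℝ}
    (hu : ∀ i j, i ≠ j → ∀ x, u i x * u j x = 0) (θ : Fin M → Bool) (x y : Fin n → ℝ) :
    ∏ i, ENNReal.ofReal (Real.exp (((∑ j, boolSign (θ j) * u j (x i)) * y i -
        (∑ j, boolSign (θ j) * u j (x i)) ^ 2 / 2) / σ ^ 2)) =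
      ∏ j, ENNReal.ofReal (Real.exp (boolSign (θ j) * (∑ i, u j (x i) / σ ^ 2 * y i) -
        (∑ i, u j (x i) ^ 2 / σ ^ 2) / 2)) := by
  rw [← ENNReal.ofReal_prod_of_nonneg fun _ _ => (Real.exp_pos _).le,
    ← ENNReal.ofReal_prod_of_nonneg fun _ _ => (Real.exp_pos _).le, ← Real.exp_sum,
    ← Real.exp_sum]
  congr 2
  have h1 : ∀ i, (∑ j, boolSign (θ j) * u j (x i)) ^ 2 = ∑ j, u j (x i) ^ 2 := by
    intro i
    rw [sum_sq_eq_of_mul_eq_zero]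
    · simp [mul_pow, boolSign_sq]
    · intro j l hjl
      linear_combination boolSign (θ j) * boolSign (θ l) * hu j l hjl (x i)
  simp_rw [h1, Finset.mul_sum, Finset.sum_div, Finset.sum_mul, ← Finset.sum_sub_distrib,
    Finset.sum_div]
  rw [Finset.sum_comm]
  refine Finset.sum_congr rfl fun j _ => Finset.sum_congr rfl fun i _ => ?_
  ring

/-- The mean, given the design, of the product of the better likelihood ratios of the signs. -/
theorem lintegral_prod_half_exp_abs_le {n M : ℕ} {σ : ℝ} (hσ : 0 < σ) {u : Fin M → ℝ → ℝ}
    (hu : ∀ i j, i ≠ j → ∀ x, u i x * u j x = 0) {lam : ℝ} (hlam : 0 < lam) (x : Fin n → ℝ) :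
    ∫⁻ y, ∏ j, ENNReal.ofReal (Real.exp (|∑ i, u j (x i) / σ ^ 2 * y i| -
        (∑ i, u j (x i) ^ 2 / σ ^ 2) / 2) / 2)
          ∂(Measure.pi fun _ : Fin n => gaussianReal 0 (σ ^ 2).toNNReal) ≤
      ∏ j, ENNReal.ofReal (1 - Real.exp (-((1 + lam) * (∑ i, u j (x i) ^ 2 / σ ^ 2) / 2)
        - Real.log 2 / lam) / 2) := by
  have hvc : ((σ ^ 2).toNNReal : ℝ) = σ ^ 2 := Real.coe_toNNReal _ (sq_nonneg σ)
  rw [lintegral_pi_prod_of_dependsOn (fun _ => gaussianReal 0 (σ ^ 2).toNNReal)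
    (F := fun j y => ENNReal.ofReal (Real.exp (|∑ i, u j (x i) / σ ^ 2 * y i| -
        (∑ i, u j (x i) ^ 2 / σ ^ 2) / 2) / 2)) (fun j => by fun_prop)
    (S := fun j => Finset.univ.filter fun i => u j (x i) ≠ 0)]
  · refine Finset.prod_le_prod' fun j _ => ?_
    have hlin : ∀ (t : ℝ) (y : Fin n → ℝ), t * ∑ i, u j (x i) / σ ^ 2 * y i =
        ∑ i, t * (u j (x i) / σ ^ 2) * y i := by
      intro t y; rw [Finset.mul_sum]; simp_rw [mul_assoc]
    refine integral_half_exp_abs_le (fun t => ?_) (fun t => ?_) hlam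
    · simp_rw [hlin]
      exact integrable_exp_sum_gaussian _ _
    · simp_rw [hlin]
      rw [integral_exp_sum_gaussian, hvc]
      congr 2
      rw [Finset.mul_sum, Finset.mul_sum]
      refine Finset.sum_congr rfl fun i _ => ?_
      field_simp
  · intro j l hjl
    rw [Finset.disjoint_left]
    intro i hi hi'
    simp only [Finset.mem_filter, Finset.mem_univ, true_and] at hi hi'
    exact (mul_ne_zero hi hi') (hu j l hjl (x i))
  · intro j y y' hyy
    have : ∑ i, u j (x i) / σ ^ 2 * y i = ∑ i, u j (x i) / σ ^ 2 * y' i := by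
      refine Finset.sum_congr rfl fun i _ => ?_
      by_cases h : u j (x i) = 0
      · simp [h]
      · rw [hyy i (by simpa using h)]
    simp only [this]

/-- The average probability of guessing all signs of a superposition of disjoint signals. -/
theorem sum_sampleLaw_le {n M : ℕ} (μ : ℝ → ℝ) [IsProbabilityMeasure (designLaw μ)] {σ : ℝ}
    (hσ : 0 < σ) {u : Fin M → ℝ → ℝ} (hum : ∀ j, Measurable (u j))
    (hu : ∀ i j, i ≠ j → ∀ x, u i x * u j x = 0) {A : (Fin M → Bool) → Set (Fin n → ℝ × ℝ)}
    (hA : ∀ θ, MeasurableSet (A θ)) (hAd : Pairwise fun θ θ' => Disjoint (A θ) (A θ')) {lam : ℝ}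
    (hlam : 0 < lam) :
    ∑ θ, sampleLaw μ (fun x => ∑ j, boolSign (θ j) * u j x) σ n (A θ) ≤
      2 ^ M * ∫⁻ x, ∏ j, ENNReal.ofReal (1 - Real.exp (-((1 + lam) * (∑ i, u j (x i) ^ 2 / σ ^ 2) / 2)
        - Real.log 2 / lam) / 2) ∂(Measure.pi fun _ : Fin n => designLaw μ) := by
  set γ := gaussianReal 0 (σ ^ 2).toNNReal with hγ
  set π := Measure.pi fun _ : Fin n => (designLaw μ).prod γ with hπ
  set D : (Fin M → Bool) → (Fin n → ℝ × ℝ) → ℝ≥0∞ := fun θ d =>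
    ∏ j, ENNReal.ofReal (Real.exp (boolSign (θ j) * (∑ i, u j (d i).1 / σ ^ 2 * (d i).2) -
        (∑ i, u j (d i).1 ^ 2 / σ ^ 2) / 2)) with hD
  set H : Fin M → (Fin n → ℝ) → (Fin n → ℝ) → ℝ≥0∞ := fun j x y =>
    ENNReal.ofReal (Real.exp (|∑ i, u j (x i) / σ ^ 2 * y i| -
        (∑ i, u j (x i) ^ 2 / σ ^ 2) / 2) / 2) with hH
  have hDm : ∀ θ, Measurable (D θ) := fun θ => by
    refine Finset.measurable_fun_prod _ fun j _ => ?_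
    have := hum j
    fun_prop
  have hHm : ∀ j, Measurable fun p : (Fin n → ℝ) × (Fin n → ℝ) => H j p.1 p.2 := fun j => by
    have := hum j
    simp only [hH]
    fun_prop
  have hlaw : ∀ θ, sampleLaw μ (fun x => ∑ j, boolSign (θ j) * u j x) σ n (A θ) =
      ∫⁻ d, (A θ).indicator (D θ) d ∂π := by
    intro θ
    rw [sampleLaw_eq_withDensity μ (by fun_prop) hσ, withDensity_apply _ (hA θ),
      lintegral_indicator (hA θ)]
    refine lintegral_congr fun d => ?_
    exact prod_likelihood_eq hu θ (fun i => (d i).1) (fun i => (d i).2)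
  -- At most one of the disjoint events contains `d`, so the sum is at most the maximal likelihood.
  -- By factorisation this is bounded by taking the better sign for each bump separately. The `2 ^
  -- M` cancels the halves in `H`.
  have hpt : ∀ d, ∑ θ, (A θ).indicator (D θ) d ≤
      2 ^ M * ∏ j, H j (fun i => (d i).1) (fun i => (d i).2) := by
    intro d
    have h2 : (2 : ℝ≥0∞) ^ M * ∏ j, H j (fun i => (d i).1) (fun i => (d i).2) =
        ∏ j, ENNReal.ofReal (Real.exp (|∑ i, u j (d i).1 / σ ^ 2 * (d i).2| -
          (∑ i, u j (d i).1 ^ 2 / σ ^ 2) / 2)) := by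
      have : (2 : ℝ≥0∞) ^ M = ∏ _j : Fin M, 2 := by simp
      rw [this, ← Finset.prod_mul_distrib]
      refine Finset.prod_congr rfl fun j _ => ?_
      rw [hH, ← ENNReal.ofReal_ofNat, ← ENNReal.ofReal_mul two_pos.le]
      congr 1; ring
    rw [h2]
    have hle : ∀ θ, D θ d ≤ ∏ j, ENNReal.ofReal (Real.exp (|∑ i, u j (d i).1 / σ ^ 2 * (d i).2| -
          (∑ i, u j (d i).1 ^ 2 / σ ^ 2) / 2)) := by
      intro θ
      refine Finset.prod_le_prod' fun j _ => ENNReal.ofReal_le_ofReal (Real.exp_le_exp.2 ?_)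
      exact sub_le_sub_right (boolSign_mul_le _ _) _
    by_cases hex : ∃ θ, d ∈ A θ
    · obtain ⟨θ, hθ⟩ := hex
      rw [Finset.sum_eq_single θ]
      · rw [indicator_of_mem hθ]; exact hle θ
      · intro θ' _ hne
        exact indicator_of_notMem (fun h => (hAd hne).le_bot ⟨h, hθ⟩) _
      · simp
    · push Not at hex
      rw [Finset.sum_eq_zero fun θ _ => indicator_of_notMem (hex θ) _]
      exact zero_le
  simp_rw [hlaw]
  rw [← lintegral_finsetSum _ fun θ _ => (hDm θ).indicator (hA θ)]
  refine (lintegral_mono hpt).trans ?_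
  rw [lintegral_const_mul _ (by
    refine Finset.measurable_fun_prod _ fun j _ => ?_
    exact (hHm j).comp (g := fun p : (Fin n → ℝ) × (Fin n → ℝ) => H j p.1 p.2)
      (f := fun d : Fin n → ℝ × ℝ => (fun i => (d i).1, fun i => (d i).2)) (by fun_prop))]
  refine mul_le_mul_right ?_ _
  have hmp := measurePreserving_arrowProdEquivProdArrow ℝ ℝ (Fin n) (fun _ => designLaw μ)
    (fun _ => γ)
  have hpm : Measurable fun p : (Fin n → ℝ) × (Fin n → ℝ) => ∏ j, H j p.1 p.2 :=
    Finset.measurable_fun_prod _ fun j _ => hHm j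
  have := hmp.lintegral_comp hpm
  refine (this.le.trans (lintegral_prod _ hpm.aemeasurable).le).trans ?_
  exact lintegral_mono fun x => lintegral_prod_half_exp_abs_le hσ hu hlam x

/-! ### Averaging over the design -/

/-- Jensen's inequality, by summing the tangent-line bounds of the exponential at the mean. -/
theorem card_mul_exp_neg_mean_le {M : ℕ} (hM : 0 < M) (V : Fin M → ℝ) (κ : ℝ) :
    M * Real.exp (-(κ * ((∑ j, V j) / M))) ≤ ∑ j, Real.exp (-(κ * V j)) := by
  set m := (∑ j, V j) / M with hm
  have hM' : (M : ℝ) ≠ 0 := by exact_mod_cast hM.ne'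
  have h1 : ∀ j, Real.exp (-(κ * m)) * (1 + κ * (m - V j)) ≤ Real.exp (-(κ * V j)) := by
    intro j
    have h2 : Real.exp (-(κ * V j)) = Real.exp (-(κ * m)) * Real.exp (κ * (m - V j)) := by
      rw [← Real.exp_add]; ring_nf
    rw [h2]
    exact mul_le_mul_of_nonneg_left (by linarith [Real.add_one_le_exp (κ * (m - V j))])
      (Real.exp_pos _).le
  refine le_trans (le_of_eq ?_) (Finset.sum_le_sum fun j _ => h1 j)
  rw [← Finset.mul_sum, Finset.sum_add_distrib, ← Finset.mul_sum, Finset.sum_sub_distrib]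
  have : (M : ℝ) * m = ∑ j, V j := by rw [hm]; field_simp
  simp [this, mul_comm]

/-- After `1 - y ≤ exp (-y)`, Jensen gives the first term when the mean of `V` is at most `v`.
Otherwise the product is below `1` and the second term above it. This second term is a Chernoff
bound ready to be integrated over the design. -/
theorem prod_one_sub_exp_le {M : ℕ} (hM : 0 < M) (V : Fin M → ℝ) {κ : ℝ} (hκ : 0 < κ)
    (b v : ℝ) :
    ∏ j, ENNReal.ofReal (1 - Real.exp (-(κ * V j) - b) / 2) ≤
      ENNReal.ofReal (Real.exp (-(M * Real.exp (-(κ * v) - b) / 2))) +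
        ENNReal.ofReal (Real.exp ((∑ j, V j) / M - v)) := by
  have h1 : ∏ j, ENNReal.ofReal (1 - Real.exp (-(κ * V j) - b) / 2) ≤
      ENNReal.ofReal (Real.exp (-∑ j, Real.exp (-(κ * V j) - b) / 2)) := by
    rw [← Finset.sum_neg_distrib, Real.exp_sum,
      ENNReal.ofReal_prod_of_nonneg fun _ _ => (Real.exp_pos _).le]
    refine Finset.prod_le_prod' fun j _ => ENNReal.ofReal_le_ofReal ?_
    linarith [Real.add_one_le_exp (-(Real.exp (-(κ * V j) - b) / 2))]
  refine h1.trans ?_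
  rcases le_or_gt ((∑ j, V j) / M) v with h | h
  · refine le_add_right (ENNReal.ofReal_le_ofReal (Real.exp_le_exp.2 (neg_le_neg ?_)))
    have h2 := card_mul_exp_neg_mean_le hM V κ
    have h3 : Real.exp (-(κ * v)) ≤ Real.exp (-(κ * ((∑ j, V j) / M))) :=
      Real.exp_le_exp.2 (by nlinarith)
    simp_rw [sub_eq_add_neg, Real.exp_add]
    rw [← Finset.sum_div, ← Finset.sum_mul]
    have h4 : (M : ℝ) * Real.exp (-(κ * v)) ≤ ∑ j, Real.exp (-(κ * V j)) :=
      (mul_le_mul_of_nonneg_left h3 (Nat.cast_nonneg M)).trans h2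
    have h5 := mul_le_mul_of_nonneg_right h4 (Real.exp_pos (-b)).le
    linarith
  · refine le_add_left (ENNReal.ofReal_le_ofReal (Real.exp_le_exp.2 ?_))
    have : 0 ≤ ∑ j, Real.exp (-(κ * V j) - b) / 2 := by positivity
    linarith

/-- For `0 ≤ g ≤ δ ≤ 1` one has `e^g ≤ 1 + g + g² ≤ 1 + (1 + δ) g`. Integrating, using `1 + y ≤ e^y`
and multiplying over the sample loses only the factor `1 + δ` in the exponent. -/
theorem lintegral_exp_sum_le {n : ℕ} (ν : Measure ℝ) [IsProbabilityMeasure ν] {g : ℝ → ℝ}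
    (hg : Measurable g) {δ a : ℝ} (hg0 : ∀ x, 0 ≤ g x) (hgδ : ∀ x, g x ≤ δ) (hδ1 : δ ≤ 1)
    (ha : 0 ≤ a) (hint : ∫⁻ x, ENNReal.ofReal (g x) ∂ν ≤ ENNReal.ofReal a) :
    ∫⁻ x, ENNReal.ofReal (Real.exp (∑ i, g (x i))) ∂(Measure.pi fun _ : Fin n => ν) ≤
      ENNReal.ofReal (Real.exp ((1 + δ) * (n * a))) := by
  have hδ0 : 0 ≤ δ := (hg0 0).trans (hgδ 0)
  simp_rw [Real.exp_sum, ENNReal.ofReal_prod_of_nonneg fun i _ => (Real.exp_pos (g _)).le]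
  rw [lintegral_pi_prod_eval (fun _ => ν) (F := fun _ y => ENNReal.ofReal (Real.exp (g y)))
    fun _ => by fun_prop]
  have h1 : ∫⁻ x, ENNReal.ofReal (Real.exp (g x)) ∂ν ≤
      ENNReal.ofReal (Real.exp ((1 + δ) * a)) := by
    have hpt : ∀ x, ENNReal.ofReal (Real.exp (g x)) ≤
        1 + ENNReal.ofReal (1 + δ) * ENNReal.ofReal (g x) := by
      intro x
      rw [← ENNReal.ofReal_one, ← ENNReal.ofReal_mul (by linarith), ← ENNReal.ofReal_add zero_le_one
        (mul_nonneg (by linarith) (hg0 x))]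
      refine ENNReal.ofReal_le_ofReal ?_
      have := Real.abs_exp_sub_one_sub_id_le (x := g x)
        (by rw [abs_of_nonneg (hg0 x)]; exact (hgδ x).trans hδ1)
      have := (abs_le.1 this).2
      nlinarith [hg0 x, hgδ x]
    refine (lintegral_mono hpt).trans ?_
    rw [lintegral_add_left measurable_const, lintegral_const_mul _ (by fun_prop)]
    simp only [lintegral_const, measure_univ, mul_one]
    refine (add_le_add_right (mul_le_mul_right hint _) _).trans ?_
    rw [← ENNReal.ofReal_one, ← ENNReal.ofReal_mul (by linarith), ← ENNReal.ofReal_add zero_le_one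
        (mul_nonneg (by linarith) ha)]
    refine ENNReal.ofReal_le_ofReal ?_
    linarith [Real.add_one_le_exp ((1 + δ) * a)]
  refine (Finset.prod_le_prod' fun i _ => h1).trans ?_
  rw [Finset.prod_const, Finset.card_univ, Fintype.card_fin,
    ← ENNReal.ofReal_pow (Real.exp_pos _).le, ← Real.exp_nat_mul]
  refine ENNReal.ofReal_le_ofReal (Real.exp_le_exp.2 (le_of_eq (by ring)))

theorem lintegral_ofReal_mean_le {M : ℕ} (hM : 0 < M) (ν : Measure ℝ) {g : Fin M → ℝ → ℝ}
    (hg : ∀ j, Measurable (g j)) {a : ℝ} (hg0 : ∀ j x, 0 ≤ g j x)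
    (hint : ∀ j, ∫⁻ x, ENNReal.ofReal (g j x) ∂ν ≤ ENNReal.ofReal a) :
    ∫⁻ x, ENNReal.ofReal ((∑ j, g j x) / M) ∂ν ≤ ENNReal.ofReal a := by
  have hM' : (M : ℝ) ≠ 0 := by exact_mod_cast hM.ne'
  have h1 : ∀ x, ENNReal.ofReal ((∑ j, g j x) / M) =
      ENNReal.ofReal ((M : ℝ)⁻¹) * ∑ j, ENNReal.ofReal (g j x) := by
    intro x
    rw [← ENNReal.ofReal_sum_of_nonneg fun j _ => hg0 j x,
      ← ENNReal.ofReal_mul (by positivity), div_eq_inv_mul]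
  simp_rw [h1]
  rw [lintegral_const_mul _ (Finset.measurable_fun_sum _ fun j _ => (hg j).ennreal_ofReal),
    lintegral_finsetSum _ fun j _ => (hg j).ennreal_ofReal]
  refine (mul_le_mul_right (Finset.sum_le_sum fun j _ => hint j) _).trans ?_
  rw [Finset.sum_const, Finset.card_univ, Fintype.card_fin, nsmul_eq_mul, ← mul_assoc,
    ← ENNReal.ofReal_natCast, ← ENNReal.ofReal_mul (by positivity), inv_mul_cancel₀ hM']
  simp

/-- The design average of the conditional probability of guessing all signs. -/
theorem lintegral_prod_one_sub_exp_le {n M : ℕ} (hM : 0 < M) (ν : Measure ℝ)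
    [IsProbabilityMeasure ν] {g : Fin M → ℝ → ℝ} (hg : ∀ j, Measurable (g j)) {δ a κ : ℝ}
    (hg0 : ∀ j x, 0 ≤ g j x) (hgδ : ∀ j x, g j x ≤ δ) (hδ1 : δ ≤ 1) (ha : 0 ≤ a)
    (hint : ∀ j, ∫⁻ x, ENNReal.ofReal (g j x) ∂ν ≤ ENNReal.ofReal a) (hκ : 0 < κ) (b v : ℝ) :
    ∫⁻ x, ∏ j, ENNReal.ofReal (1 - Real.exp (-(κ * ∑ i, g j (x i)) - b) / 2)
        ∂(Measure.pi fun _ : Fin n => ν) ≤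
      ENNReal.ofReal (Real.exp (-(M * Real.exp (-(κ * v) - b) / 2))) +
        ENNReal.ofReal (Real.exp ((1 + δ) * (n * a) - v)) := by
  -- The mean over `j` of the informations is a sum over the sample of the one function `G`, which
  -- inherits the bounds `δ` and `a`.
  obtain ⟨G, hG⟩ : ∃ G : ℝ → ℝ, G = fun x => (∑ j, g j x) / M := ⟨_, rfl⟩
  have hGm : Measurable G :=
    hG ▸ (Finset.measurable_fun_sum _ fun j _ => hg j).div_const _
  have hG0 : ∀ x, 0 ≤ G x := fun x => by
    rw [hG]; exact div_nonneg (Finset.sum_nonneg fun j _ => hg0 j x) (Nat.cast_nonneg M)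
  have hGδ : ∀ x, G x ≤ δ := fun x => by
    rw [hG, div_le_iff₀ (by positivity)]
    refine (Finset.sum_le_sum fun j _ => hgδ j x).trans (le_of_eq ?_)
    simp [mul_comm]
  have h1 : ∀ x : Fin n → ℝ, ENNReal.ofReal (Real.exp ((∑ j, ∑ i, g j (x i)) / M - v)) =
      ENNReal.ofReal (Real.exp (∑ i, G (x i))) * ENNReal.ofReal (Real.exp (-v)) := by
    intro x
    rw [← ENNReal.ofReal_mul (Real.exp_pos _).le, ← Real.exp_add, Finset.sum_comm, hG,
      ← Finset.sum_div, sub_eq_add_neg]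
  have hm : Measurable fun x : Fin n → ℝ => ENNReal.ofReal (Real.exp (∑ i, G (x i))) :=
    (Real.measurable_exp.comp (Finset.measurable_fun_sum _ fun i _ =>
      hGm.comp (measurable_pi_apply i))).ennreal_ofReal
  have h2 := lintegral_exp_sum_le (n := n) ν hGm hG0 hGδ hδ1 ha
    (hG ▸ lintegral_ofReal_mean_le hM ν hg hg0 hint)
  have hpt : ∀ x : Fin n → ℝ,
      ∏ j, ENNReal.ofReal (1 - Real.exp (-(κ * ∑ i, g j (x i)) - b) / 2) ≤
        ENNReal.ofReal (Real.exp (-(M * Real.exp (-(κ * v) - b) / 2))) +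
          ENNReal.ofReal (Real.exp (∑ i, G (x i))) * ENNReal.ofReal (Real.exp (-v)) := fun x =>
    (h1 x) ▸ prod_one_sub_exp_le hM (fun j => ∑ i, g j (x i)) hκ b v
  calc _ ≤ ∫⁻ x, (ENNReal.ofReal (Real.exp (-(M * Real.exp (-(κ * v) - b) / 2))) +
          ENNReal.ofReal (Real.exp (∑ i, G (x i))) * ENNReal.ofReal (Real.exp (-v)))
          ∂(Measure.pi fun _ : Fin n => ν) := lintegral_mono hpt
    _ = ENNReal.ofReal (Real.exp (-(M * Real.exp (-(κ * v) - b) / 2))) +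
          (∫⁻ x, ENNReal.ofReal (Real.exp (∑ i, G (x i))) ∂(Measure.pi fun _ : Fin n => ν)) *
            ENNReal.ofReal (Real.exp (-v)) := by
      rw [lintegral_add_left measurable_const, lintegral_mul_const _ hm, lintegral_const,
        measure_univ, mul_one]
    _ ≤ _ := by
      rw [sub_eq_add_neg ((1 + δ) * (n * a)), Real.exp_add ((1 + δ) * (n * a)),
        ENNReal.ofReal_mul (Real.exp_pos ((1 + δ) * (n * a))).le]
      gcongr

/-! ### Mollification in the Hölder class -/

open scoped Convolution ContDiff

theorem holderOrder_lt {s : ℝ} (hs : 0 < s) : (holderOrder s : ℝ) < s := by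
  have h1 : 1 ≤ ⌈s⌉₊ := Nat.one_le_ceil_iff.2 hs
  have h2 := Nat.ceil_lt_add_one hs.le
  rw [holderOrder, Nat.cast_sub h1]
  push_cast; linarith

theorem le_holderOrder_add_one {s : ℝ} (hs : 0 < s) : s ≤ holderOrder s + 1 := by
  have h1 : 1 ≤ ⌈s⌉₊ := Nat.one_le_ceil_iff.2 hs
  rw [holderOrder, Nat.cast_sub h1]
  push_cast; linarith [Nat.le_ceil s]

theorem mem_holderBall_univ {s L : ℝ} {φ : ℝ → ℝ} :
    φ ∈ holderBall s L univ ↔ ContDiff ℝ (holderOrder s) φ ∧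
      ∀ x y, |iteratedDeriv (holderOrder s) φ x - iteratedDeriv (holderOrder s) φ y| ≤
        L * |x - y| ^ (s - (holderOrder s : ℝ)) := by
  simp [holderBall, contDiffOn_univ]

theorem eLpNorm_two_le_one_iff (φ : ℝ → ℝ) :
    eLpNorm φ 2 volume ≤ 1 ↔ ∫⁻ x, ENNReal.ofReal (φ x ^ 2) ≤ 1 := by
  have h : ∀ x, ‖φ x‖ₑ ^ (2 : ℝ) = ENNReal.ofReal (φ x ^ 2) := by
    intro x
    rw [Real.enorm_eq_ofReal_abs, ENNReal.ofReal_rpow_of_nonneg (abs_nonneg _) two_pos.le,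
      Real.rpow_two, sq_abs]
  rw [eLpNorm_eq_lintegral_rpow_enorm_toReal (by simp) (by simp)]
  simp only [ENNReal.toReal_ofNat, h]
  constructor
  · intro hle
    by_contra! hlt
    exact absurd hle (not_le.2 (ENNReal.one_lt_rpow hlt (by norm_num)))
  · intro hle
    exact ENNReal.rpow_le_one hle (by norm_num)

theorem integrable_sq_of_lintegral_le_one {φ : ℝ → ℝ} (hc : Continuous φ)
    (h : ∫⁻ x, ENNReal.ofReal (φ x ^ 2) ≤ 1) : Integrable fun x => φ x ^ 2 := by
  refine ⟨(hc.pow 2).aestronglyMeasurable, ?_⟩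
  rw [hasFiniteIntegral_iff_ofReal (ae_of_all _ fun x => sq_nonneg _)]
  exact h.trans_lt ENNReal.one_lt_top

theorem HasCompactSupport.iteratedDeriv_real {f : ℝ → ℝ} (hf : HasCompactSupport f) (j : ℕ) :
    HasCompactSupport (iteratedDeriv j f) := by
  induction j with
  | zero => simpa using hf
  | succ j ih => rw [iteratedDeriv_succ]; exact ih.deriv

theorem ContDiff.iteratedDeriv_smooth {f : ℝ → ℝ} (hf : ContDiff ℝ ∞ f) (j : ℕ) :
    ContDiff ℝ ∞ (iteratedDeriv j f) := by
  rw [iteratedDeriv_eq_iterate]; exact hf.iterate_deriv j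

/-- The convolution of two real functions. -/
noncomputable def realConv (ρ φ : ℝ → ℝ) : ℝ → ℝ :=
  ρ ⋆[ContinuousLinearMap.lsmul ℝ ℝ, volume] φ

theorem realConv_apply (ρ φ : ℝ → ℝ) (x : ℝ) : realConv ρ φ x = ∫ t, ρ t * φ (x - t) := by
  simp [realConv, convolution_def]

section Mollify

variable {ρ φ : ℝ → ℝ}

theorem integrable_mul_comp_sub (hρ : Continuous ρ) (hρc : HasCompactSupport ρ)
    (hφ : Continuous φ) (x : ℝ) : Integrable fun t => ρ t * φ (x - t) :=
  Continuous.integrable_of_hasCompactSupport (by fun_prop) hρc.mul_right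

theorem contDiff_realConv (hρ : ContDiff ℝ ∞ ρ) (hρc : HasCompactSupport ρ)
    (hφ : Continuous φ) : ContDiff ℝ ∞ (realConv ρ φ) :=
  hρc.contDiff_convolution_left _ hρ hφ.locallyIntegrable

theorem deriv_realConv (hρ : ContDiff ℝ ∞ ρ) (hρc : HasCompactSupport ρ) (hφ : Continuous φ) :
    deriv (realConv ρ φ) = realConv (deriv ρ) φ := by
  ext x
  exact (hρc.hasDerivAt_convolution_left _ (hρ.of_le (by norm_cast))
    hφ.locallyIntegrable x).deriv

theorem iteratedDeriv_realConv (hρ : ContDiff ℝ ∞ ρ) (hρc : HasCompactSupport ρ)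
    (hφ : Continuous φ) (j : ℕ) :
    iteratedDeriv j (realConv ρ φ) = realConv (iteratedDeriv j ρ) φ := by
  induction j with
  | zero => simp
  | succ j ih =>
    rw [iteratedDeriv_succ, ih, deriv_realConv (hρ.iteratedDeriv_smooth j)
      (hρc.iteratedDeriv_real j) hφ, iteratedDeriv_succ]

theorem deriv_realConv_right (hρ : ContDiff ℝ ∞ ρ) (hρc : HasCompactSupport ρ)
    (hφ : ContDiff ℝ 1 φ) : deriv (realConv ρ φ) = realConv ρ (deriv φ) := by
  rw [deriv_realConv hρ hρc hφ.continuous]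
  ext x
  have hd : Continuous (deriv φ) := hφ.continuous_deriv le_rfl
  have hρd : Continuous (deriv ρ) := hρ.continuous_deriv (by norm_cast)
  have hφ' : ∀ t, HasDerivAt (fun t => φ (x - t)) (-deriv φ (x - t)) t := fun t => by
    have := ((hφ.differentiable one_ne_zero) (x - t)).hasDerivAt.comp_const_sub x t
    simpa using this
  have hρ' : ∀ t, HasDerivAt ρ (deriv ρ t) t := fun t =>
    ((hρ.differentiable (by simp)) t).hasDerivAt
  have h1 : Integrable fun t => ρ t * deriv φ (x - t) :=
    integrable_mul_comp_sub hρ.continuous hρc hd x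
  have key := integral_mul_deriv_eq_deriv_mul_of_integrable (fun t _ => hρ' t)
    (fun t _ => hφ' t) (by simpa [Pi.mul_def] using h1.neg)
    (integrable_mul_comp_sub hρd hρc.deriv hφ.continuous x)
    (integrable_mul_comp_sub hρ.continuous hρc hφ.continuous x)
  rw [realConv_apply, realConv_apply]
  simp only [mul_neg, integral_neg, neg_inj] at key
  exact key.symm

/-- Integration by parts moves derivatives from `ρ` to `φ` as long as `φ` has them. Derivatives on
`φ` transmit the Hölder bound; derivatives on `ρ`, of any order, give smoothness and uniform bounds.
-/
theorem iteratedDeriv_realConv_right (hρ : ContDiff ℝ ∞ ρ) (hρc : HasCompactSupport ρ) (k : ℕ) :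
    ∀ φ : ℝ → ℝ, ContDiff ℝ k φ →
      iteratedDeriv k (realConv ρ φ) = realConv ρ (iteratedDeriv k φ) := by
  induction k with
  | zero => intro φ _; simp
  | succ k ih =>
    intro φ hφ
    have hφ2 : ContDiff ℝ k (deriv φ) :=
      ((contDiff_succ_iff_deriv (n := (k : WithTop ℕ∞))).1 (by exact_mod_cast hφ)).2.2
    have hφ1 : ContDiff ℝ 1 φ := hφ.of_le (by norm_cast; omega)
    rw [iteratedDeriv_succ', deriv_realConv_right hρ hρc hφ1, ih _ hφ2, iteratedDeriv_succ']

/-- From `|ab| ≤ a² + b²`: square integrability of `φ` suffices. Applied to the derivatives of a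
mollifier, it bounds every derivative of the mollified function. -/
theorem abs_realConv_le (hρ : Continuous ρ) (hρc : HasCompactSupport ρ)
    (hi : Integrable fun x => φ x ^ 2) (x : ℝ) :
    |realConv ρ φ x| ≤ (∫ t, ρ t ^ 2) + ∫ t, φ t ^ 2 := by
  have h1 : Integrable fun t => ρ t ^ 2 :=
    Continuous.integrable_of_hasCompactSupport (by fun_prop)
      (hρc.comp_left (g := fun y => y ^ 2) (by simp))
  have h2 : Integrable fun t => φ (x - t) ^ 2 := hi.comp_sub_left x
  have h3 : ∫ t, φ (x - t) ^ 2 = ∫ t, φ t ^ 2 :=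
    integral_sub_left_eq_self (fun t => φ t ^ 2) volume x
  rw [realConv_apply, ← h3, ← integral_add h1 h2]
  rw [← Real.norm_eq_abs]
  refine norm_integral_le_of_norm_le (h1.add h2) (ae_of_all _ fun t => ?_)
  rw [Real.norm_eq_abs, abs_le]
  constructor <;>
    nlinarith [sq_nonneg (ρ t + φ (x - t)), sq_nonneg (ρ t - φ (x - t)), sq_nonneg (ρ t),
      sq_nonneg (φ (x - t))]

/-- The variance of `φ (x - ·)` under the probability density `ρ` is nonnegative. -/
theorem realConv_sq_le (hρ : Continuous ρ) (hρc : HasCompactSupport ρ) (h0 : ∀ t, 0 ≤ ρ t)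
    (h1 : ∫ t, ρ t = 1) (hφ : Continuous φ) (x : ℝ) :
    realConv ρ φ x ^ 2 ≤ ∫ t, ρ t * φ (x - t) ^ 2 := by
  set m := realConv ρ φ x with hm
  have i1 : Integrable fun t => ρ t * φ (x - t) ^ 2 :=
    Continuous.integrable_of_hasCompactSupport (by fun_prop) hρc.mul_right
  have i2 : Integrable fun t => 2 * m * (ρ t * φ (x - t)) :=
    (integrable_mul_comp_sub hρ hρc hφ x).const_mul _
  have i3 : Integrable fun t => m ^ 2 * ρ t := (hρ.integrable_of_hasCompactSupport hρc).const_mul _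
  have i4 : Integrable fun t => ρ t * φ (x - t) ^ 2 - 2 * m * (ρ t * φ (x - t)) := i1.sub i2
  have h2 : 0 ≤ ∫ t, (ρ t * φ (x - t) ^ 2 - 2 * m * (ρ t * φ (x - t)) + m ^ 2 * ρ t) := by
    refine integral_nonneg fun t => ?_
    have : ρ t * φ (x - t) ^ 2 - 2 * m * (ρ t * φ (x - t)) + m ^ 2 * ρ t =
      ρ t * (φ (x - t) - m) ^ 2 := by ring
    simp only [Pi.zero_apply, this]
    exact mul_nonneg (h0 t) (sq_nonneg _)
  rw [integral_add i4 i3, integral_sub i1 i2, integral_const_mul, integral_const_mul, h1,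
    ← realConv_apply, ← hm] at h2
  nlinarith

theorem lintegral_realConv_sq_le (hρ : Continuous ρ) (hρc : HasCompactSupport ρ)
    (h0 : ∀ t, 0 ≤ ρ t) (h1 : ∫ t, ρ t = 1) (hφ : Continuous φ) :
    ∫⁻ x, ENNReal.ofReal (realConv ρ φ x ^ 2) ≤ ∫⁻ x, ENNReal.ofReal (φ x ^ 2) := by
  calc ∫⁻ x, ENNReal.ofReal (realConv ρ φ x ^ 2)
      ≤ ∫⁻ x, ∫⁻ t, ENNReal.ofReal (ρ t) * ENNReal.ofReal (φ (x - t) ^ 2) := by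
        refine lintegral_mono fun x => ?_
        refine (ENNReal.ofReal_le_ofReal (realConv_sq_le hρ hρc h0 h1 hφ x)).trans (le_of_eq ?_)
        have hi : Integrable fun t => ρ t * φ (x - t) ^ 2 :=
          Continuous.integrable_of_hasCompactSupport (by fun_prop) hρc.mul_right
        rw [ofReal_integral_eq_lintegral_ofReal hi
          (ae_of_all _ fun t => mul_nonneg (h0 t) (sq_nonneg _))]
        exact lintegral_congr fun t => ENNReal.ofReal_mul (h0 t)
    _ = ∫⁻ t, ∫⁻ x, ENNReal.ofReal (ρ t) * ENNReal.ofReal (φ (x - t) ^ 2) := by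
        refine lintegral_lintegral_swap (Measurable.aemeasurable ?_)
        have := hρ.measurable
        have := hφ.measurable
        simp only [Function.uncurry_def]
        fun_prop
    _ = ∫⁻ t, ENNReal.ofReal (ρ t) * ∫⁻ x, ENNReal.ofReal (φ x ^ 2) := by
        refine lintegral_congr fun t => ?_
        have := hφ.measurable
        rw [lintegral_const_mul _ (by fun_prop),
          lintegral_sub_right_eq_self (fun x => ENNReal.ofReal (φ x ^ 2)) t]
    _ = ∫⁻ x, ENNReal.ofReal (φ x ^ 2) := by
        have hi : Integrable ρ := hρ.integrable_of_hasCompactSupport hρc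
        rw [lintegral_mul_const _ hρ.measurable.ennreal_ofReal,
          ← ofReal_integral_eq_lintegral_ofReal hi (ae_of_all _ h0), h1]
        simp

theorem abs_realConv_sub_le (hρ : Continuous ρ) (hρc : HasCompactSupport ρ)
    (h0 : ∀ t, 0 ≤ ρ t) (h1 : ∫ t, ρ t = 1) (hφ : Continuous φ) {x y C : ℝ}
    (h : ∀ t, |φ (x - t) - φ (y - t)| ≤ C) : |realConv ρ φ x - realConv ρ φ y| ≤ C := by
  rw [realConv_apply, realConv_apply, ← integral_sub (integrable_mul_comp_sub hρ hρc hφ x)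
    (integrable_mul_comp_sub hρ hρc hφ y)]
  have i1 := (hρ.integrable_of_hasCompactSupport (μ := volume) hρc).mul_const C
  rw [← Real.norm_eq_abs]
  refine (norm_integral_le_of_norm_le i1 (ae_of_all _ fun t => ?_)).trans (le_of_eq ?_)
  · rw [← mul_sub, norm_mul, Real.norm_of_nonneg (h0 t)]
    exact mul_le_mul_of_nonneg_left (h t) (h0 t)
  · rw [integral_mul_const, h1, one_mul]

end Mollify

/-- Functions of the recovery class are approximated at the origin by smooth ones all of whose
derivatives are bounded. -/
theorem exists_smooth_mem_recoveryClass {s : ℝ} {φ : ℝ → ℝ}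
    (hφ : φ ∈ recoveryClass s) {τ : ℝ} (hτ : 0 < τ) :
    ∃ ψ ∈ recoveryClass s, ContDiff ℝ ∞ ψ ∧ φ 0 - τ ≤ ψ 0 ∧
      ∀ j : ℕ, ∃ C, ∀ x, |iteratedDeriv j ψ x| ≤ C := by
  obtain ⟨hφ1, hφ2⟩ := hφ
  rw [mem_holderBall_univ] at hφ1
  obtain ⟨hφk, hφh⟩ := hφ1
  rw [eLpNorm_two_le_one_iff] at hφ2
  have hc : Continuous φ := hφk.continuous
  obtain ⟨η, hη, hη'⟩ := Metric.continuous_iff.1 hc 0 τ hτ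
  let f : ContDiffBump (0 : ℝ) := ⟨η / 2, η, by positivity, by linarith⟩
  set ρ := f.normed volume with hρdef
  have hρ : ContDiff ℝ ∞ ρ := f.contDiff_normed
  have hρc : HasCompactSupport ρ := f.hasCompactSupport_normed
  have h0 : ∀ t, 0 ≤ ρ t := f.nonneg_normed
  have h1 : ∫ t, ρ t = 1 := f.integral_normed
  refine ⟨realConv ρ φ, ⟨?_, ?_⟩, contDiff_realConv hρ hρc hc, ?_, fun j => ?_⟩
  · rw [mem_holderBall_univ]
    refine ⟨(contDiff_realConv hρ hρc hc).of_le (by norm_cast; exact le_top), fun x y => ?_⟩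
    rw [iteratedDeriv_realConv_right hρ hρc _ _ hφk]
    refine abs_realConv_sub_le hρ.continuous hρc h0 h1 (hφk.continuous_iteratedDeriv' _)
      fun t => ?_
    simpa using hφh (x - t) (y - t)
  · rw [eLpNorm_two_le_one_iff]
    exact (lintegral_realConv_sq_le hρ.continuous hρc h0 h1 hc).trans hφ2
  · have := ContDiffBump.dist_normed_convolution_le (φ := f) (μ := volume) (x₀ := 0) (ε := τ)
      hc.aestronglyMeasurable (fun x hx => (hη' x hx).le)
    rw [Real.dist_eq] at this
    linarith [(abs_le.1 this).1, show realConv ρ φ 0 =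
      (f.normed volume ⋆[ContinuousLinearMap.lsmul ℝ ℝ, volume] φ) 0 from rfl]
  · refine ⟨(∫ t, iteratedDeriv j ρ t ^ 2) + ∫ t, φ t ^ 2, fun x => ?_⟩
    rw [iteratedDeriv_realConv hρ hρc hc]
    exact abs_realConv_le (hρ.iteratedDeriv_smooth j).continuous (hρc.iteratedDeriv_real j)
      (integrable_sq_of_lintegral_le_one hc hφ2) x

/-! ### Truncation in the Hölder class -/

/-- At distances at most `1` use the mean value theorem and `|x - y| ≤ |x - y| ^ a`; at larger ones
the trivial bound `2 B`. -/
theorem abs_sub_le_mul_rpow {F : ℝ → ℝ} (hF : Differentiable ℝ F) {B a : ℝ}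
    (hB : ∀ x, |F x| ≤ B) (hB' : ∀ x, |deriv F x| ≤ B) (ha0 : 0 < a) (ha1 : a ≤ 1) (x y : ℝ) :
    |F x - F y| ≤ 2 * B * |x - y| ^ a := by
  have hB0 : 0 ≤ B := (abs_nonneg _).trans (hB 0)
  rcases le_total |x - y| 1 with h | h
  · have h1 : |F x - F y| ≤ B * |x - y| :=
      Convex.norm_image_sub_le_of_norm_deriv_le (fun z _ => hF z) (fun z _ => hB' z) convex_univ
        (mem_univ y) (mem_univ x)
    have h2 : |x - y| ≤ |x - y| ^ a := by
      rcases (abs_nonneg (x - y)).eq_or_lt with h0 | h0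
      · rw [← h0, Real.zero_rpow ha0.ne']
      · simpa using Real.rpow_le_rpow_of_exponent_ge h0 h ha1
    nlinarith [abs_nonneg (x - y)]
  · have h1 : |F x - F y| ≤ 2 * B := (abs_sub _ _).trans (by linarith [hB x, hB y])
    have h2 : 1 ≤ |x - y| ^ a := Real.one_le_rpow h ha0.le
    nlinarith

theorem abs_mul_sub_mul_le {p p' r r' α β η : ℝ} (h1 : |p - p'| ≤ η) (h2 : |r| ≤ α)
    (h3 : |p'| ≤ β) {η' : ℝ} (h4 : |r - r'| ≤ η') : |p * r - p' * r'| ≤ η * α + β * η' := by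
  have : p * r - p' * r' = (p - p') * r + p' * (r - r') := by ring
  rw [this]
  refine (abs_add_le _ _).trans (add_le_add ?_ ?_) <;> rw [abs_mul]
  · exact mul_le_mul h1 h2 (abs_nonneg _) ((abs_nonneg _).trans h1)
  · exact mul_le_mul h3 h4 (abs_nonneg _) ((abs_nonneg _).trans h3)

theorem exists_forall_le_bound (k : ℕ) {G : ℕ → ℝ → ℝ} (h : ∀ j, ∃ C, ∀ x, |G j x| ≤ C) :
    ∃ B, 0 ≤ B ∧ ∀ j ≤ k, ∀ x, |G j x| ≤ B := by
  choose C hC using h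
  have hC0 : ∀ j, 0 ≤ C j := fun j => (abs_nonneg _).trans (hC j 0)
  refine ⟨∑ j ∈ Finset.range (k + 1), C j, Finset.sum_nonneg fun j _ => hC0 j, fun j hj x => ?_⟩
  exact (hC j x).trans (Finset.single_le_sum (f := C) (fun i _ => hC0 i)
    (Finset.mem_range.2 (by omega)))

theorem exists_iteratedDeriv_bound {f : ℝ → ℝ} (hf : ContDiff ℝ ∞ f) (hc : HasCompactSupport f)
    (j : ℕ) : ∃ C, ∀ x, |iteratedDeriv j f x| ≤ C :=
  (hc.iteratedDeriv_real j).exists_bound_of_continuous (hf.iteratedDeriv_smooth j).continuous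

/-- Truncating a smooth function at a large scale hardly increases its Hölder constant. -/
theorem exists_truncation_bound {ψ χ : ℝ → ℝ} (hψ : ContDiff ℝ ∞ ψ) (hχ : ContDiff ℝ ∞ χ)
    (hψb : ∀ j : ℕ, ∃ C, ∀ x, |iteratedDeriv j ψ x| ≤ C)
    (hχb : ∀ j : ℕ, ∃ C, ∀ x, |iteratedDeriv j χ x| ≤ C) (hχ1 : ∀ x, |χ x| ≤ 1)
    {a : ℝ} (ha0 : 0 < a) (ha1 : a ≤ 1) {k : ℕ}
    (hk : ∀ x y, |iteratedDeriv k ψ x - iteratedDeriv k ψ y| ≤ |x - y| ^ a) :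
    ∃ C, 0 ≤ C ∧ ∀ c, 0 < c → c ≤ 1 → ∀ x y,
      |iteratedDeriv k (fun z => ψ z * χ (c * z)) x - iteratedDeriv k (fun z => ψ z * χ (c * z)) y| ≤
        (1 + C * c ^ a) * |x - y| ^ a := by
  obtain ⟨B₁, hB₁, hψB⟩ := exists_forall_le_bound (k + 1) hψb
  obtain ⟨B₂, hB₂, hχB⟩ := exists_forall_le_bound (k + 1) hχb
  have hψH : ∀ j ≤ k, ∀ x y, |iteratedDeriv j ψ x - iteratedDeriv j ψ y| ≤
      2 * B₁ * |x - y| ^ a := fun j hj x y =>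
    abs_sub_le_mul_rpow ((hψ.iteratedDeriv_smooth j).differentiable (by simp))
      (hψB j (by omega)) (fun z => by rw [← iteratedDeriv_succ]; exact hψB (j + 1) (by omega) z)
      ha0 ha1 x y
  have hχH : ∀ c, 0 < c → ∀ j ≤ k, ∀ x y, |iteratedDeriv j χ (c * x) - iteratedDeriv j χ (c * y)| ≤
      2 * B₂ * c ^ a * |x - y| ^ a := fun c hc j hj x y => by
    have := abs_sub_le_mul_rpow ((hχ.iteratedDeriv_smooth j).differentiable (by simp))
      (hχB j (by omega)) (fun z => by rw [← iteratedDeriv_succ]; exact hχB (j + 1) (by omega) z)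
      ha0 ha1 (c * x) (c * y)
    rwa [← mul_sub, abs_mul, abs_of_pos hc, Real.mul_rpow hc.le (abs_nonneg _),
      ← mul_assoc] at this
  refine ⟨(∑ i ∈ Finset.range k, (k.choose i : ℝ) * (4 * B₁ * B₂)) + 2 * B₁ * B₂, by positivity,
    fun c hc hc1 x y => ?_⟩
  have hca : c ≤ c ^ a := by simpa using Real.rpow_le_rpow_of_exponent_ge hc hc1 ha1
  have hca1 : c ^ a ≤ 1 := Real.rpow_le_one hc.le hc1 ha0.le
  have hca0 : 0 < c ^ a := Real.rpow_pos_of_pos hc a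
  set d := |x - y| ^ a with hd
  have hd0 : 0 ≤ d := by positivity
  -- In Leibniz' rule every term with `i < k` carries `c ^ (k - i) ≤ c ^ a`. The isolated term `i =
  -- k` has Hölder constant `1` from `ψ`, because `|χ| ≤ 1`, plus a multiple of `c ^ a` from the
  -- slow variation of `χ (c * ·)`.
  have hleib : ∀ z, iteratedDeriv k (fun z => ψ z * χ (c * z)) z =
      (∑ i ∈ Finset.range k, (k.choose i : ℝ) * c ^ (k - i) *
        (iteratedDeriv i ψ z * iteratedDeriv (k - i) χ (c * z))) +
      iteratedDeriv k ψ z * χ (c * z) := by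
    intro z
    have h1 : ContDiffAt ℝ k ψ z := (hψ.of_le (by norm_cast; exact le_top)).contDiffAt
    have h2 : ContDiff ℝ k fun z => χ (c * z) :=
      (hχ.comp (contDiff_const.mul contDiff_id)).of_le (by norm_cast; exact le_top)
    have h3 := iteratedDeriv_mul h1 h2.contDiffAt
    rw [Pi.mul_def] at h3
    rw [h3, Finset.sum_range_succ]
    congr 1
    · refine Finset.sum_congr rfl fun i hi => ?_
      have h4 : ContDiff ℝ ((k - i : ℕ)) χ := contDiff_infty.1 hχ _
      rw [iteratedDeriv_comp_const_mul h4 c]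
      ring
    · simp
  rw [hleib x, hleib y]
  have hterm : ∀ i ∈ Finset.range k, |(k.choose i : ℝ) * c ^ (k - i) *
        (iteratedDeriv i ψ x * iteratedDeriv (k - i) χ (c * x)) - (k.choose i : ℝ) * c ^ (k - i) *
        (iteratedDeriv i ψ y * iteratedDeriv (k - i) χ (c * y))| ≤
      (k.choose i : ℝ) * (4 * B₁ * B₂) * (c ^ a * d) := by
    intro i hi
    rw [Finset.mem_range] at hi
    rw [← mul_sub, abs_mul, abs_of_nonneg (by positivity)]
    have h1 := abs_mul_sub_mul_le (hψH i hi.le x y) (hχB (k - i) (by omega) (c * x))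
      (hψB i (by omega) y) (hχH c hc (k - i) (by omega) x y)
    have h2 : c ^ (k - i) ≤ c ^ a := (pow_le_of_le_one hc.le hc1 (by omega)).trans hca
    have h3 : B₁ * (2 * B₂ * c ^ a * d) ≤ B₁ * (2 * B₂ * 1 * d) := by gcongr
    calc _ ≤ (k.choose i : ℝ) * c ^ a * (4 * B₁ * B₂ * d) := by
          gcongr
          refine h1.trans ?_
          rw [← hd]
          linarith
      _ = _ := by ring
  have hlast := abs_mul_sub_mul_le (hk x y) (hχ1 (c * x)) (hψB k (by omega) y)
    (hχH c hc 0 (by omega) x y)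
  simp only [iteratedDeriv_zero] at hlast
  rw [add_sub_add_comm, ← Finset.sum_sub_distrib]
  refine (abs_add_le _ _).trans ((add_le_add ((Finset.abs_sum_le_sum_abs _ _).trans
    (Finset.sum_le_sum hterm)) hlast).trans (le_of_eq ?_))
  rw [← Finset.sum_mul]
  ring

/-- A cutoff at a scale so large that the Hölder constant is at most `1 + τ` becomes admissible
after division by `1 + τ`. Neither operation increases the `L²` norm. -/
theorem exists_hasCompactSupport_mem_recoveryClass {s : ℝ} (hs : 0 < s) {ψ : ℝ → ℝ}
    (hψ : ψ ∈ recoveryClass s) (hψs : ContDiff ℝ ∞ ψ)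
    (hψb : ∀ j : ℕ, ∃ C, ∀ x, |iteratedDeriv j ψ x| ≤ C) {τ : ℝ} (hτ : 0 < τ) :
    ∃ φ ∈ recoveryClass s, ContDiff ℝ ∞ φ ∧ HasCompactSupport φ ∧ φ 0 = ψ 0 / (1 + τ) := by
  obtain ⟨hψ1, hψ2⟩ := hψ
  rw [mem_holderBall_univ] at hψ1
  rw [eLpNorm_two_le_one_iff] at hψ2
  set a := s - (holderOrder s : ℝ) with ha
  have ha0 : 0 < a := by linarith [holderOrder_lt hs]
  have ha1 : a ≤ 1 := by linarith [le_holderOrder_add_one hs]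
  let χ : ContDiffBump (0 : ℝ) := ⟨1, 2, one_pos, one_lt_two⟩
  have hχ : ContDiff ℝ ∞ χ := χ.contDiff
  have hχ1 : ∀ x, |χ x| ≤ 1 := fun x => abs_le.2 ⟨by linarith [χ.nonneg (x := x)], χ.le_one⟩
  obtain ⟨C, hC0, hC⟩ := exists_truncation_bound hψs hχ hψb
    (exists_iteratedDeriv_bound hχ χ.hasCompactSupport) hχ1 ha0 ha1
    (by simpa using hψ1.2)
  obtain ⟨c, hc, hc1, hcC⟩ : ∃ c : ℝ, 0 < c ∧ c ≤ 1 ∧ C * c ^ a ≤ τ := by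
    refine ⟨min 1 ((τ / (C + 1)) ^ a⁻¹), lt_min one_pos (by positivity), min_le_left _ _, ?_⟩
    have h1 : (min 1 ((τ / (C + 1)) ^ a⁻¹)) ^ a ≤ τ / (C + 1) := by
      refine (Real.rpow_le_rpow (by positivity) (min_le_right _ _) ha0.le).trans (le_of_eq ?_)
      rw [← Real.rpow_mul (by positivity), inv_mul_cancel₀ ha0.ne', Real.rpow_one]
    calc _ ≤ C * (τ / (C + 1)) := by gcongr
      _ ≤ τ := by rw [mul_div_assoc', div_le_iff₀ (by positivity)]; nlinarith
  set g : ℝ → ℝ := fun z => ψ z * χ (c * z) with hg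
  have hgs : ContDiff ℝ ∞ g := hψs.mul (hχ.comp (contDiff_const.mul contDiff_id))
  have hτ1 : (1 + τ)⁻¹ ≤ 1 := inv_le_one_of_one_le₀ (by linarith)
  refine ⟨fun z => (1 + τ)⁻¹ * g z, ⟨?_, ?_⟩, contDiff_const.mul hgs, ?_, ?_⟩
  · rw [mem_holderBall_univ]
    refine ⟨(contDiff_const.mul hgs).of_le (by norm_cast; exact le_top), fun x y => ?_⟩
    rw [iteratedDeriv_const_mul_field, iteratedDeriv_const_mul_field, ← mul_sub, abs_mul,
      abs_of_pos (by positivity), one_mul, inv_mul_le_iff₀ (by positivity)]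
    refine (hC c hc hc1 x y).trans ?_
    gcongr
  · rw [eLpNorm_two_le_one_iff]
    refine (lintegral_mono fun x => ENNReal.ofReal_le_ofReal ?_).trans hψ2
    have h1 : |(1 + τ)⁻¹ * g x| ≤ |ψ x| := by
      rw [hg, abs_mul, abs_mul, abs_of_pos (by positivity : 0 < (1 + τ)⁻¹)]
      calc (1 + τ)⁻¹ * (|ψ x| * |χ (c * x)|) ≤ 1 * (|ψ x| * 1) := by
            gcongr; exact hχ1 _
        _ = |ψ x| := by ring
    exact sq_le_sq.2 h1
  · have h1 : HasCompactSupport fun z => χ (c * z) :=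
      χ.hasCompactSupport.comp_homeomorph (Homeomorph.mulLeft₀ c hc.ne')
    exact (h1.mul_left (f := ψ)).mul_left (f := fun _ => (1 + τ)⁻¹)
  · have : χ (c * 0) = 1 := by
      rw [mul_zero]; exact χ.one_of_mem_closedBall (by simp [χ.rIn_pos.le])
    simp only [hg, this]
    field_simp

theorem zero_mem_recoveryClass (s : ℝ) : (fun _ => 0 : ℝ → ℝ) ∈ recoveryClass s := by
  refine ⟨mem_holderBall_univ.2 ⟨contDiff_const, fun x y => ?_⟩, by simp⟩
  have : iteratedDeriv (holderOrder s) (fun _ : ℝ => (0 : ℝ)) = fun _ => 0 := by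
    ext x; simp
  rw [this]
  simp only [sub_self, abs_zero, one_mul]
  positivity

theorem recoveryValue_nonneg {s : ℝ} (hs : 0 < s) : 0 ≤ recoveryValue s :=
  le_csSup (bddAbove_recovery hs) ⟨_, zero_mem_recoveryClass s, rfl⟩

/-- The recovery problem has smooth near-solutions of compact support. -/
theorem exists_smooth_near_recoveryValue {s : ℝ} (hs : 0 < s) {δ : ℝ} (hδ : 0 < δ) :
    ∃ φ ∈ recoveryClass s, ContDiff ℝ ∞ φ ∧ HasCompactSupport φ ∧
      (1 - δ) * recoveryValue s ≤ φ 0 := by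
  rcases (recoveryValue_nonneg hs).eq_or_lt with h0 | h0
  · refine ⟨_, zero_mem_recoveryClass s, contDiff_const, HasCompactSupport.zero, ?_⟩
    simp [← h0]
  have hne : ((fun φ : ℝ → ℝ => φ 0) '' recoveryClass s).Nonempty :=
    ⟨_, _, zero_mem_recoveryClass s, rfl⟩
  set r := recoveryValue s with hr
  -- Near-maximality and mollification each cost `δ / 4 * r`, truncation a factor `1 + δ / 2`; and
  -- `(1 - δ) (1 + δ / 2) ≤ 1 - δ / 2`.
  obtain ⟨_, ⟨φ, hφ, rfl⟩, hφr⟩ := exists_lt_of_lt_csSup hne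
    (show r - δ / 4 * r < sSup _ by rw [← recoveryValue, ← hr]; nlinarith)
  obtain ⟨ψ, hψ, hψs, hψ0, hψb⟩ := exists_smooth_mem_recoveryClass hφ
    (τ := δ / 4 * r) (by positivity)
  obtain ⟨g, hg, hgs, hgc, hg0⟩ := exists_hasCompactSupport_mem_recoveryClass hs hψ hψs hψb
    (τ := δ / 2) (by positivity)
  refine ⟨g, hg, hgs, hgc, ?_⟩
  rw [hg0, le_div_iff₀ (by positivity)]
  have h1 : r - δ / 2 * r ≤ ψ 0 := by
    simp only at hφr; linarith
  nlinarith [mul_pos hδ h0, mul_pos (mul_pos hδ hδ) h0]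

/-! ### Superpositions of well separated bumps -/

/-- The rescaled bump `L h ^ s φ((z - x₀) / h)`. -/
noncomputable def scaledBump (s L : ℝ) (φ : ℝ → ℝ) (x₀ h : ℝ) : ℝ → ℝ :=
  fun z => L * h ^ s * φ (h⁻¹ * (z - x₀))

theorem contDiff_scaledBump {s L x₀ h : ℝ} {φ : ℝ → ℝ} (hφ : ContDiff ℝ ∞ φ) :
    ContDiff ℝ ∞ (scaledBump s L φ x₀ h) :=
  contDiff_const.mul (hφ.comp (contDiff_const.mul (contDiff_id.sub contDiff_const)))

theorem iteratedDeriv_scaledBump {s L x₀ h : ℝ} (hh : 0 < h) {φ : ℝ → ℝ} (hφ : ContDiff ℝ ∞ φ)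
    (k : ℕ) (z : ℝ) : iteratedDeriv k (scaledBump s L φ x₀ h) z =
      L * h ^ (s - k) * iteratedDeriv k φ (h⁻¹ * (z - x₀)) := by
  unfold scaledBump
  rw [iteratedDeriv_const_mul_field,
    iteratedDeriv_comp_sub_const k (fun z => φ (h⁻¹ * z)) x₀,
    iteratedDeriv_comp_const_mul (contDiff_infty.1 hφ k) h⁻¹, Real.rpow_sub hh, Real.rpow_natCast,
    inv_pow]
  ring

/-- At each point at most one summand is nonzero. If a single index serves both `z` and `z'`, its
own bound `D` applies. Otherwise the points are at least `ρ` apart, and then the crude bound `2 b`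
is no larger than `D`. -/
theorem abs_sum_sub_sum_le {M : ℕ} {G : Fin M → ℝ → ℝ} {x : Fin M → ℝ} {z z' D b r ρ : ℝ}
    (hD : 0 ≤ D) (hG : ∀ j, |G j z - G j z'| ≤ D) (hb : ∀ j y, |G j y| ≤ b)
    (hr : ∀ j y, G j y ≠ 0 → |y - x j| ≤ r) (hρ : 0 < ρ)
    (hx : ∀ i j, i ≠ j → 2 * r + ρ ≤ |x i - x j|) (hfar : ρ ≤ |z - z'| → 2 * b ≤ D) :
    |∑ j, G j z - ∑ j, G j z'| ≤ D := by
  have huniq : ∀ y j, G j y ≠ 0 → ∀ i, i ≠ j → G i y = 0 := by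
    intro y j hj i hij
    by_contra hi
    have h1 := hr j y hj
    have h2 := hr i y hi
    have h3 := hx i j hij
    have h4 : |x i - x j| ≤ |y - x i| + |y - x j| := by
      have := abs_sub (y - x j) (y - x i)
      rw [sub_sub_sub_cancel_left] at this
      linarith
    linarith
  have hsum : ∀ y j, (∀ i, i ≠ j → G i y = 0) → ∑ i, G i y = G j y := fun y j h =>
    Finset.sum_eq_single j (fun i _ hi => h i hi) (by simp)
  by_cases hz : ∃ j, G j z ≠ 0
  · obtain ⟨j, hj⟩ := hz
    rw [hsum z j (huniq z j hj)]
    by_cases hz' : ∃ i, G i z' ≠ 0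
    · obtain ⟨i, hi⟩ := hz'
      rw [hsum z' i (huniq z' i hi)]
      by_cases hij : i = j
      · rw [hij]; exact hG j
      · have h1 := hr j z hj
        have h2 := hr i z' hi
        have h3 := hx i j hij
        have h4 : |x i - x j| ≤ |z - x j| + |z - z'| + |z' - x i| := by
          have h5 : x i - x j = (z - x j) - (z - z') - (z' - x i) := by ring
          rw [h5]
          exact (abs_sub _ _).trans (add_le_add_left (abs_sub _ _) _)
        refine (abs_sub _ _).trans (le_trans ?_ (hfar (by linarith)))
        linarith [hb j z, hb i z']
    · push Not at hz'
      rw [Finset.sum_eq_zero fun i _ => hz' i, ← hz' j]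
      exact hG j
  · push Not at hz
    rw [Finset.sum_eq_zero fun i _ => hz i]
    by_cases hz' : ∃ i, G i z' ≠ 0
    · obtain ⟨i, hi⟩ := hz'
      rw [hsum z' i (huniq z' i hi), ← hz i]
      exact hG i
    · push Not at hz'
      rw [Finset.sum_eq_zero fun i _ => hz' i]
      simpa using hD

theorem exists_support_radius {f : ℝ → ℝ} (hf : HasCompactSupport f) :
    ∃ R, 0 < R ∧ ∀ y, f y ≠ 0 → |y| ≤ R := by
  obtain ⟨R, hR⟩ := hf.isCompact.isBounded.subset_closedBall 0
  refine ⟨max R 1, by positivity, fun y hy => ?_⟩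
  have := hR (subset_tsupport f hy)
  rw [mem_closedBall_zero_iff, Real.norm_eq_abs] at this
  exact this.trans (le_max_left _ _)

/-- Bumps `L h ^ s φ((z - x₀) / h)` of widths `h ≤ H` at mutual distances `≥ K H` do not interact:
their supports are disjoint, and sums with signs have the Hölder constant of a single bump. -/
def SeparatesBumps (s : ℝ) (φ : ℝ → ℝ) (K : ℝ) : Prop :=
  ∀ ⦃M : ℕ⦄ (L H : ℝ) (x h : Fin M → ℝ), 0 < L → 0 < H → (∀ j, 0 < h j) →
    (∀ j, h j ≤ H) → (∀ i j, i ≠ j → K * H ≤ |x i - x j|) →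
    (∀ i j, i ≠ j → ∀ z,
      scaledBump s L φ (x i) (h i) z * scaledBump s L φ (x j) (h j) z = 0) ∧
    (∀ i j, i ≠ j → scaledBump s L φ (x j) (h j) (x i) = 0) ∧
    ∀ θ : Fin M → Bool,
      (fun z => ∑ j, boolSign (θ j) * scaledBump s L φ (x j) (h j) z) ∈ holderBall s L (Icc 0 1)

theorem exists_separatesBumps {s : ℝ} (hs : 0 < s) {φ : ℝ → ℝ} (hφ : φ ∈ holderBall s 1 univ)
    (hφs : ContDiff ℝ ∞ φ) (hφc : HasCompactSupport φ) : ∃ K, 0 < K ∧ SeparatesBumps s φ K := by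
  rw [mem_holderBall_univ] at hφ
  set k := holderOrder s with hk
  set a := s - (k : ℝ) with ha
  have ha0 : 0 < a := by linarith [holderOrder_lt hs]
  obtain ⟨R₀, hR₀, hsupp₀⟩ := exists_support_radius hφc
  obtain ⟨R₁, hR₁, hsupp₁⟩ := exists_support_radius (hφc.iteratedDeriv_real k)
  obtain ⟨B, hB⟩ := exists_iteratedDeriv_bound hφs hφc k
  have hB0 : 0 ≤ B := (abs_nonneg _).trans (hB 0)
  set R := max R₀ R₁ with hR
  have hR0 : 0 < R := lt_max_of_lt_left hR₀
  -- Across a gap of at least `Λ H`, `L |z - z'| ^ a` exceeds `2 B L H ^ a`, twice the bound on the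
  -- `k`-th derivative of a bump. So different bumps do not double the Hölder constant. The extra
  -- `1` in `K` keeps the gap positive when `B = 0`.
  set Λ := (2 * B) ^ a⁻¹ with hΛ
  have hΛ0 : 0 ≤ Λ := by positivity
  have hΛa : Λ ^ a = 2 * B := by
    rw [hΛ, ← Real.rpow_mul (by positivity), inv_mul_cancel₀ ha0.ne', Real.rpow_one]
  refine ⟨2 * R + (Λ + 1), by positivity, ?_⟩
  intro M L H x h hL hH hh hhH hsep
  have hnear : ∀ j z, |(h j)⁻¹ * (z - x j)| ≤ R → |z - x j| ≤ R * H := by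
    intro j z hz
    rw [abs_mul, abs_of_pos (inv_pos.2 (hh j)), inv_mul_le_iff₀ (hh j)] at hz
    refine hz.trans ?_
    rw [mul_comm]
    exact mul_le_mul_of_nonneg_left (hhH j) hR0.le
  have hbsupp : ∀ j z, scaledBump s L φ (x j) (h j) z ≠ 0 → |z - x j| ≤ R * H := by
    intro j z hz
    refine hnear j z ((hsupp₀ _ fun h0 => hz ?_).trans (le_max_left _ _))
    simp [scaledBump, h0]
  refine ⟨fun i j hij z => ?_, fun i j hij => ?_, fun θ => ?_⟩
  · by_contra hne
    have h1 := hbsupp i z (left_ne_zero_of_mul hne)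
    have h2 := hbsupp j z (right_ne_zero_of_mul hne)
    have h3 := hsep i j hij
    have h4 : |x i - x j| ≤ |z - x i| + |z - x j| := by
      have := abs_sub (z - x j) (z - x i)
      rw [sub_sub_sub_cancel_left] at this
      linarith
    nlinarith
  · by_contra hne
    have h1 := hbsupp j (x i) hne
    have h3 := hsep i j hij
    nlinarith
  · set f : ℝ → ℝ := fun z => ∑ j, boolSign (θ j) * scaledBump s L φ (x j) (h j) z with hf
    have hfs : ContDiff ℝ ∞ f := ContDiff.sum fun j _ => contDiff_const.mul
      (contDiff_scaledBump hφs)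
    have hfk : ContDiff ℝ k f := contDiff_infty.1 hfs k
    have hfd : ∀ z, iteratedDeriv k f z = ∑ j, boolSign (θ j) *
        (L * h j ^ a * iteratedDeriv k φ ((h j)⁻¹ * (z - x j))) := by
      intro z
      rw [hf, iteratedDeriv_fun_sum fun j _ =>
        (contDiff_infty.1 (contDiff_const.mul (contDiff_scaledBump hφs)) k).contDiffAt]
      refine Finset.sum_congr rfl fun j _ => ?_
      rw [iteratedDeriv_const_mul_field, iteratedDeriv_scaledBump (hh j) hφs]
    refine ⟨hfk.contDiffOn, fun z hz z' hz' => ?_⟩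
    rw [← hk, iteratedDerivWithin_eq_iteratedDeriv (uniqueDiffOn_Icc zero_lt_one)
      hfk.contDiffAt hz, iteratedDerivWithin_eq_iteratedDeriv (uniqueDiffOn_Icc zero_lt_one)
      hfk.contDiffAt hz', hfd, hfd, ← ha]
    refine abs_sum_sub_sum_le (G := fun j z => boolSign (θ j) *
        (L * h j ^ a * iteratedDeriv k φ ((h j)⁻¹ * (z - x j)))) (x := x) (b := L * H ^ a * B)
        (r := R * H) (ρ := (Λ + 1) * H) (by positivity) (fun j => ?_) (fun j y => ?_)
        (fun j y hy => ?_) (by positivity) (fun i j hij => ?_) (fun hfar => ?_)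
    · have hha := Real.rpow_pos_of_pos (hh j) a
      rw [← mul_sub, abs_mul, abs_boolSign, one_mul, ← mul_sub, abs_mul,
        abs_of_pos (mul_pos hL hha)]
      have h1 := hφ.2 ((h j)⁻¹ * (z - x j)) ((h j)⁻¹ * (z' - x j))
      rw [← mul_sub, sub_sub_sub_cancel_right, one_mul, abs_mul,
        abs_of_pos (inv_pos.2 (hh j)), Real.mul_rpow (inv_pos.2 (hh j)).le (abs_nonneg _),
        Real.inv_rpow (hh j).le] at h1
      calc _ ≤ L * h j ^ a * ((h j ^ a)⁻¹ * |z - z'| ^ a) := by gcongr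
        _ = L * |z - z'| ^ a := by field_simp
    · have hha := Real.rpow_pos_of_pos (hh j) a
      rw [abs_mul, abs_boolSign, one_mul, abs_mul, abs_of_pos (mul_pos hL hha)]
      have h2 : h j ^ a ≤ H ^ a := Real.rpow_le_rpow (hh j).le (hhH j) ha0.le
      gcongr
      exact hB _
    · refine hnear j y ((hsupp₁ _ fun h0 => hy ?_).trans (le_max_right _ _))
      simp [h0]
    · exact le_trans (le_of_eq (by ring)) (hsep i j hij)
    · have h1 : (Λ * H) ^ a ≤ |z - z'| ^ a :=
        Real.rpow_le_rpow (by positivity) (by nlinarith) ha0.le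
      rw [Real.mul_rpow hΛ0 hH.le, hΛa] at h1
      nlinarith

theorem abs_sum_boolSign_mul_le {M : ℕ} {u : Fin M → ℝ → ℝ}
    (hu : ∀ i j, i ≠ j → ∀ z, u i z * u j z = 0) {b : ℝ} (hb0 : 0 ≤ b) (hb : ∀ j z, |u j z| ≤ b)
    (θ : Fin M → Bool) (z : ℝ) : |∑ j, boolSign (θ j) * u j z| ≤ b := by
  by_cases h : ∃ j, u j z ≠ 0
  · obtain ⟨j, hj⟩ := h
    rw [Finset.sum_eq_single j]
    · rw [abs_mul, abs_boolSign, one_mul]; exact hb j z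
    · intro i _ hij
      rw [(mul_eq_zero.1 (hu i j hij z)).resolve_right hj, mul_zero]
    · simp
  · push Not at h
    simpa [h] using hb0

theorem abs_scaledBump_le {s L x₀ h H B : ℝ} (hs : 0 < s) (hL : 0 < L) (hh : 0 < h) (hH : h ≤ H)
    {φ : ℝ → ℝ} (hB : ∀ y, |φ y| ≤ B) (z : ℝ) :
    |scaledBump s L φ x₀ h z| ≤ L * H ^ s * B := by
  have hhs := Real.rpow_pos_of_pos hh s
  rw [scaledBump, abs_mul, abs_of_pos (mul_pos hL hhs)]
  have h2 : h ^ s ≤ H ^ s := Real.rpow_le_rpow hh.le hH hs.le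
  have := hhs.trans_le h2
  gcongr
  exact hB _

/-! ### The design density and the information of a bump -/

theorem IsDesignDensity.continuousOn {μ : ℝ → ℝ} (hμ : IsDesignDensity μ) :
    ContinuousOn μ (Icc 0 1) := by
  obtain ⟨⟨ν, ϱ, q, -, -, -, -, hμ1, -⟩, -⟩ := hμ
  exact hμ1.1.continuousOn

theorem IsDesignDensity.exists_pos_le {μ : ℝ → ℝ} (hμ : IsDesignDensity μ) :
    ∃ q, 0 < q ∧ ∀ x ∈ Icc (0 : ℝ) 1, q ≤ μ x := by
  obtain ⟨⟨ν, ϱ, q, -, -, -, hq, -, hμq⟩, -⟩ := hμ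
  exact ⟨q, hq, hμq⟩

theorem IsDesignDensity.isProbabilityMeasure {μ : ℝ → ℝ} (hμ : IsDesignDensity μ) :
    IsProbabilityMeasure (designLaw μ) := by
  obtain ⟨q, hq, hμq⟩ := hμ.exists_pos_le
  have hi : IntegrableOn μ (Icc 0 1) := hμ.continuousOn.integrableOn_Icc
  constructor
  rw [designLaw, withDensity_apply _ MeasurableSet.univ, Measure.restrict_univ,
    ← ofReal_integral_eq_lintegral_ofReal hi, hμ.2, ENNReal.ofReal_one]
  exact (ae_restrict_iff' measurableSet_Icc).2 (ae_of_all _ fun x hx => hq.le.trans (hμq x hx))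

theorem lintegral_sq_comp_affine {φ : ℝ → ℝ} (hφ : Continuous φ)
    (h1 : ∫⁻ x, ENNReal.ofReal (φ x ^ 2) ≤ 1) {h : ℝ} (hh : 0 < h) (x₀ : ℝ) :
    ∫⁻ x, ENNReal.ofReal (φ (h⁻¹ * (x - x₀)) ^ 2) ≤ ENNReal.ofReal h := by
  have hi : Integrable fun x => φ x ^ 2 := integrable_sq_of_lintegral_le_one hφ h1
  have hi2 : Integrable fun x => φ (h⁻¹ * (x - x₀)) ^ 2 :=
    (hi.comp_mul_left' (inv_ne_zero hh.ne')).comp_sub_right x₀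
  rw [← ofReal_integral_eq_lintegral_ofReal hi (ae_of_all _ fun x => sq_nonneg _),
    ENNReal.ofReal_le_one] at h1
  rw [← ofReal_integral_eq_lintegral_ofReal hi2 (ae_of_all _ fun x => sq_nonneg _)]
  refine ENNReal.ofReal_le_ofReal ?_
  rw [integral_sub_right_eq_self (fun x => φ (h⁻¹ * x) ^ 2) x₀,
    Measure.integral_comp_mul_left (fun x => φ x ^ 2) h⁻¹, inv_inv, abs_of_pos hh, smul_eq_mul]
  nlinarith

/-- The information about a bump carried by one observation. -/
theorem lintegral_scaledBump_sq_le {μ : ℝ → ℝ} (hμ : IsDesignDensity μ) {s L σ h R m x₀ : ℝ}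
    (hh : 0 < h) {φ : ℝ → ℝ} (hφ : Continuous φ)
    (h1 : ∫⁻ x, ENNReal.ofReal (φ x ^ 2) ≤ 1) (hR : ∀ y, φ y ≠ 0 → |y| ≤ R)
    (hm0 : 0 ≤ m) (hm : ∀ x ∈ Icc (0 : ℝ) 1, |x - x₀| ≤ R * h → μ x ≤ m) :
    ∫⁻ x, ENNReal.ofReal (scaledBump s L φ x₀ h x ^ 2 / σ ^ 2) ∂(designLaw μ) ≤
      ENNReal.ofReal (L ^ 2 * (h ^ s) ^ 2 * h * m / σ ^ 2) := by
  have hmeas : AEMeasurable (fun x => ENNReal.ofReal (μ x)) (volume.restrict (Icc (0 : ℝ) 1)) :=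
    (hμ.continuousOn.aemeasurable measurableSet_Icc).ennreal_ofReal
  have hm2 : Measurable fun x => ENNReal.ofReal (φ (h⁻¹ * (x - x₀)) ^ 2) := by
    have := hφ.measurable
    fun_prop
  have hm3 : Measurable fun x => ENNReal.ofReal (scaledBump s L φ x₀ h x ^ 2 / σ ^ 2) := by
    have := hφ.measurable
    unfold scaledBump
    fun_prop
  rw [designLaw, lintegral_withDensity_eq_lintegral_mul₀ hmeas hm3.aemeasurable]
  calc _ ≤ ∫⁻ x in Icc (0 : ℝ) 1, ENNReal.ofReal (L ^ 2 * (h ^ s) ^ 2 * m / σ ^ 2) *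
        ENNReal.ofReal (φ (h⁻¹ * (x - x₀)) ^ 2) := by
        refine setLIntegral_mono (hm2.const_mul _) fun x hx => ?_
        rw [Pi.mul_apply]
        by_cases h0 : φ (h⁻¹ * (x - x₀)) = 0
        · simp [scaledBump, h0]
        · have h2 := hR _ h0
          rw [abs_mul, abs_of_pos (inv_pos.2 hh), inv_mul_le_iff₀ hh, mul_comm] at h2
          have h3 := hm x hx h2
          refine (mul_le_mul_left (ENNReal.ofReal_le_ofReal h3) _).trans (le_of_eq ?_)
          rw [← ENNReal.ofReal_mul hm0, ← ENNReal.ofReal_mul (by positivity)]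
          congr 1
          simp only [scaledBump]
          ring
    _ ≤ ∫⁻ x, ENNReal.ofReal (L ^ 2 * (h ^ s) ^ 2 * m / σ ^ 2) *
        ENNReal.ofReal (φ (h⁻¹ * (x - x₀)) ^ 2) := setLIntegral_le_lintegral _ _
    _ ≤ ENNReal.ofReal (L ^ 2 * (h ^ s) ^ 2 * m / σ ^ 2) * ENNReal.ofReal h := by
        rw [lintegral_const_mul _ hm2]
        exact mul_le_mul_right (lintegral_sq_comp_affine hφ h1 hh x₀) _
    _ = _ := by
        rw [← ENNReal.ofReal_mul (by positivity)]
        congr 1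
        ring

/-! ### Reduction of the minimax risk to guessing signs -/

/-- If the superpositions of disjoint signals `u j` belong to the parameter set, the minimax risk
is bounded below through the probability of guessing all signs. -/
theorem ofReal_loss_le_supMinimaxRisk_add {s L Q σ : ℝ} (hσ : 0 < σ) {μ w : ℝ → ℝ}
    [IsProbabilityMeasure (designLaw μ)] {n M : ℕ}
    {I : Set ℝ} (hI : I ⊆ Icc 0 1) {x : Fin M → ℝ} (hx : ∀ j, x j ∈ I) {u : Fin M → ℝ → ℝ}
    (hum : ∀ j, Measurable (u j)) (hu : ∀ i j, i ≠ j → ∀ z, u i z * u j z = 0)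
    (hux : ∀ i j, i ≠ j → u j (x i) = 0)
    (hf : ∀ θ : Fin M → Bool, (fun z => ∑ j, boolSign (θ j) * u j z) ∈ boundedHolderBall s L Q)
    {t : ℝ} (ht : 0 ≤ t) (hrate : ∀ j, 0 < rate s μ n (x j))
    (hut : ∀ j, t * rate s μ n (x j) ≤ u j (x j)) {lam : ℝ} (hlam : 0 < lam) {η : ℝ≥0∞}
    (hη : ∫⁻ x, ∏ j, ENNReal.ofReal (1 - Real.exp (-((1 + lam) * (∑ i, u j (x i) ^ 2 / σ ^ 2) / 2)
        - Real.log 2 / lam) / 2) ∂(Measure.pi fun _ : Fin n => designLaw μ) ≤ η) :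
    ENNReal.ofReal (w t) ≤ supMinimaxRisk s L Q σ μ w n I + ENNReal.ofReal (w t) * η := by
  -- The error term is moved to the left so that the infimum can be treated estimator by estimator.
  rw [← tsub_le_iff_right]
  refine le_iInf₂ fun T hT => ?_
  rw [tsub_le_iff_right]
  set F : (Fin M → Bool) → ℝ → ℝ := fun θ z => ∑ j, boolSign (θ j) * u j z with hF
  have hFm : ∀ θ, Measurable (F θ) := fun θ =>
    Finset.measurable_fun_sum _ fun j _ => (hum j).const_mul _
  have hFx : ∀ θ j, F θ (x j) = boolSign (θ j) * u j (x j) := fun θ j =>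
    Finset.sum_eq_single j (fun i _ hij => by rw [hux j i hij.symm, mul_zero]) (by simp)
  set S := ⨆ f ∈ boundedHolderBall s L Q,
    ∫⁻ d, extLoss w (normError s μ n I (T d) f) ∂(sampleLaw μ f σ n) with hS
  -- The event that the estimator identifies `θ`. These events are disjoint because flipping the
  -- sign `j` moves the value at `x j` by `2 u j (x j)`. Off `A θ` some point `x j` has normalised
  -- error at least `t`.
  set A : (Fin M → Bool) → Set (Fin n → ℝ × ℝ) := fun θ =>
    {d | ∀ j, |T d (x j) - F θ (x j)| < u j (x j)} with hA
  have hTm : ∀ j, Measurable fun d => T d (x j) := fun j => hT _ (hI (hx j))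
  have hAm : ∀ θ, MeasurableSet (A θ) := by
    intro θ
    simp only [hA, ofPred_forall]
    exact MeasurableSet.iInter fun j => measurableSet_lt
      ((hTm j).sub_const _).norm measurable_const
  have hAd : Pairwise fun θ θ' => Disjoint (A θ) (A θ') := by
    intro θ θ' hne
    rw [Set.disjoint_left]
    intro d hd hd'
    obtain ⟨j, hj⟩ := Function.ne_iff.1 hne
    have h1 := hd j
    have h2 := hd' j
    rw [hFx] at h1 h2
    rw [abs_lt] at h1 h2
    cases hθ : θ j <;> cases hθ' : θ' j <;> simp_all [boolSign] <;> linarith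
  have hone : ∀ θ, ENNReal.ofReal (w t) ≤
      S + ENNReal.ofReal (w t) * sampleLaw μ (F θ) σ n (A θ) := by
    intro θ
    have : IsProbabilityMeasure (sampleLaw μ (F θ) σ n) :=
      isProbabilityMeasure_sampleLaw μ (hFm θ) σ n
    have h1 : ENNReal.ofReal (w t) * sampleLaw μ (F θ) σ n (A θ)ᶜ ≤ S := by
      refine le_trans ?_ (le_iSup₂ (f := fun f (_ : f ∈ boundedHolderBall s L Q) =>
        ∫⁻ d, extLoss w (normError s μ n I (T d) f) ∂(sampleLaw μ f σ n)) (F θ) (hf θ))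
      -- The loss need not be measurable: it dominates a multiple of the indicator of a measurable
      -- set, which bounds the lower integral.
      rw [← lintegral_indicator_const (hAm θ).compl]
      refine lintegral_mono fun d => ?_
      by_cases hd : d ∈ A θ
      · simp [hd]
      · rw [indicator_of_mem hd]
        simp only [hA, mem_ofPred_eq, not_forall, not_lt] at hd
        obtain ⟨j, hj⟩ := hd
        have h2 : t ≤ (rate s μ n (x j))⁻¹ * |T d (x j) - F θ (x j)| := by
          rw [le_inv_mul_iff₀ (hrate j), mul_comm]
          exact (hut j).trans hj
        have h3 : ((t.toNNReal : ℝ≥0) : ℝ≥0∞) ≤ normError s μ n I (T d) (F θ) :=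
          (ENNReal.ofReal_le_ofReal h2).trans (le_iSup₂ (f := fun y (_ : y ∈ I) =>
            ENNReal.ofReal ((rate s μ n y)⁻¹ * |T d y - F θ y|)) (x j) (hx j))
        have h4 := le_iSup₂ (f := fun (r : ℝ≥0)
          (_ : (r : ℝ≥0∞) ≤ normError s μ n I (T d) (F θ)) => ENNReal.ofReal (w r)) t.toNNReal h3
        rwa [Real.coe_toNNReal t ht] at h4
    calc ENNReal.ofReal (w t) = ENNReal.ofReal (w t) *
          (sampleLaw μ (F θ) σ n (A θ)ᶜ + sampleLaw μ (F θ) σ n (A θ)) := by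
          rw [add_comm, measure_add_measure_compl (hAm θ), measure_univ, mul_one]
      _ ≤ _ := by rw [mul_add]; gcongr
  -- Uniform prior: the bounds are summed over all `2 ^ M` sign vectors, and the factor `2 ^ M` is
  -- cancelled at the end.
  have hsum := Finset.sum_le_sum fun θ (_ : θ ∈ Finset.univ) => hone θ
  have hguess := sum_sampleLaw_le (n := n) μ hσ hum hu hAm hAd hlam
  rw [Finset.sum_add_distrib, ← Finset.mul_sum, Finset.sum_const, Finset.sum_const,
    Finset.card_univ, Fintype.card_fun, Fintype.card_bool, Fintype.card_fin, nsmul_eq_mul,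
    nsmul_eq_mul] at hsum
  push_cast at hsum
  have h5 : (2 : ℝ≥0∞) ^ M * ENNReal.ofReal (w t) ≤
      2 ^ M * (S + ENNReal.ofReal (w t) * η) := by
    calc _ ≤ 2 ^ M * S + ENNReal.ofReal (w t) * (2 ^ M * η) := by
          refine hsum.trans ?_
          gcongr
          exact hguess.trans (by gcongr)
      _ = _ := by ring
  exact (ENNReal.mul_le_mul_iff_right (by simp) (by simp)).1 h5

/-! ### The lower bound for a fixed sample size -/

/-- The bandwidth at `x j` depends on `μ (x j)`: it makes the height a fixed multiple of the local
rate, while `h j ^ (2 s + 1) * μ (x j) = c log n / n` gives all bumps the same information bound.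
`H` dominates all bandwidths and fixes the spacing; the threshold `v` for the mean information is
left free. -/
theorem ofReal_loss_le_supMinimaxRisk_add_exp {s L Q σ c q δ B R K t : ℝ} (hs : 0 < s) (hL : 0 < L)
    (hσ : 0 < σ) (hc : 0 < c) (hq : 0 < q) (hδ : 0 < δ) (hδ1 : δ ≤ 1) {μ w : ℝ → ℝ}
    (hμ : IsDesignDensity μ) (hμq : ∀ x ∈ Icc (0 : ℝ) 1, q ≤ μ x)
    {φ : ℝ → ℝ} (hφ : φ ∈ recoveryClass s) (hφs : ContDiff ℝ ∞ φ)
    (hR : ∀ y, φ y ≠ 0 → |y| ≤ R) (hB : ∀ y, |φ y| ≤ B) (hK : SeparatesBumps s φ K)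
    {n : ℕ} (hn : 1 < n) {H : ℝ} (hH : H = (c * Real.log n / (n * q)) ^ (1 / (2 * s + 1)))
    (hHQ : L * H ^ s * B ≤ Q) (hHδ : (L * H ^ s * B) ^ 2 / σ ^ 2 ≤ δ)
    (hHμ : ∀ x ∈ Icc (0 : ℝ) 1, ∀ y ∈ Icc (0 : ℝ) 1, |x - y| ≤ R * H → |μ x - μ y| ≤ δ * q)
    (ht : 0 ≤ t) (htφ : t ≤ L * c ^ (s / (2 * s + 1)) * φ 0)
    {M : ℕ} (hM : 0 < M) {I : Set ℝ} (hI : I ⊆ Icc 0 1) {x : Fin M → ℝ} (hx : ∀ j, x j ∈ I)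
    (hsep : ∀ i j, i ≠ j → K * H ≤ |x i - x j|) (v : ℝ) :
    ENNReal.ofReal (w t) ≤ supMinimaxRisk s L Q σ μ w n I + ENNReal.ofReal (w t) *
      (ENNReal.ofReal (Real.exp (-(M * Real.exp (-((1 + δ) / 2 * v) - Real.log 2 / δ) / 2))) +
        ENNReal.ofReal (Real.exp
          ((1 + δ) * (n * ((1 + δ) * (L ^ 2 * c / σ ^ 2) * Real.log n / n)) - v))) := by
  have hprob := hμ.isProbabilityMeasure
  have hn0 : (0 : ℝ) < n := by exact_mod_cast (by omega : 0 < n)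
  have hlog : 0 < Real.log n := Real.log_pos (by exact_mod_cast hn)
  have hs2 : 0 < 2 * s + 1 := by linarith
  have hx01 : ∀ j, x j ∈ Icc (0 : ℝ) 1 := fun j => hI (hx j)
  have hμx : ∀ j, 0 < μ (x j) := fun j => hq.trans_le (hμq _ (hx01 j))
  have hH0 : 0 < H := by rw [hH]; positivity
  set h : Fin M → ℝ := fun j => (c * Real.log n / (n * μ (x j))) ^ (1 / (2 * s + 1)) with hh
  have hbase : ∀ j, 0 < c * Real.log n / (n * μ (x j)) := fun j => by
    have := hμx j
    positivity
  have hh0 : ∀ j, 0 < h j := fun j => Real.rpow_pos_of_pos (hbase j) _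
  have hhH : ∀ j, h j ≤ H := fun j => by
    rw [hH]
    refine Real.rpow_le_rpow (hbase j).le ?_ (by positivity)
    have := hμq _ (hx01 j)
    gcongr
  obtain ⟨hdisj, hzero, hmem⟩ := hK L H x h hL hH0 hh0 hhH hsep
  set u : Fin M → ℝ → ℝ := fun j => scaledBump s L φ (x j) (h j) with hu
  have hub : ∀ j z, |u j z| ≤ L * H ^ s * B := fun j z =>
    abs_scaledBump_le hs hL (hh0 j) (hhH j) hB z
  have hb0 : 0 ≤ L * H ^ s * B :=
    mul_nonneg (by positivity) ((abs_nonneg _).trans (hB 0))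
  have hum : ∀ j, Measurable (u j) := fun j => (contDiff_scaledBump hφs).continuous.measurable
  have hrate : ∀ j, 0 < rate s μ n (x j) := fun j => by
    have := hμx j
    unfold rate; positivity
  have huv : ∀ j, u j (x j) = L * c ^ (s / (2 * s + 1)) * φ 0 * rate s μ n (x j) := by
    intro j
    have h1 : h j ^ s = c ^ (s / (2 * s + 1)) * rate s μ n (x j) := by
      have := hμx j
      rw [hh, ← Real.rpow_mul (hbase j).le, rate, ← Real.mul_rpow hc.le (by positivity)]
      congr 1 <;> ring
    simp only [hu, scaledBump, sub_self, mul_zero, h1]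
    ring
  refine ofReal_loss_le_supMinimaxRisk_add hσ hI hx hum hdisj hzero
    (fun θ => ⟨hmem θ, fun z _ => (abs_sum_boolSign_mul_le hdisj hb0 hub θ z).trans hHQ⟩) ht hrate
    (fun j => ?_) hδ ?_
  · rw [huv]
    exact mul_le_mul_of_nonneg_right htφ (hrate j).le
  · have key := lintegral_prod_one_sub_exp_le (n := n) hM (designLaw μ)
      (g := fun j z => u j z ^ 2 / σ ^ 2) (fun j => ((hum j).pow_const 2).div_const _)
      (δ := δ) (a := (1 + δ) * (L ^ 2 * c / σ ^ 2) * Real.log n / n) (κ := (1 + δ) / 2)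
      (fun j z => by positivity) (fun j z => ?_) hδ1 (by positivity) (fun j => ?_) (by positivity)
      (Real.log 2 / δ) v
    · refine le_trans (le_of_eq ?_) key
      refine lintegral_congr fun y => Finset.prod_congr rfl fun j _ => ?_
      rw [mul_div_right_comm]
    · refine le_trans ?_ hHδ
      have h1 : u j z ^ 2 ≤ (L * H ^ s * B) ^ 2 := sq_le_sq' (abs_le.1 (hub j z)).1
        (abs_le.1 (hub j z)).2
      gcongr
    · refine (lintegral_scaledBump_sq_le hμ (hh0 j) hφs.continuous
        ((eLpNorm_two_le_one_iff φ).1 hφ.2) hR (m := (1 + δ) * μ (x j)) ?_ ?_).trans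
          (le_of_eq ?_)
      · have := hμx j
        positivity
      · intro z hz hzx
        have hR0 : 0 ≤ R := by
          by_contra hneg
          have := (abs_nonneg (z - x j)).trans hzx
          nlinarith [hh0 j]
        have h1 := (abs_le.1 (hHμ z hz (x j) (hx01 j)
          (hzx.trans (mul_le_mul_of_nonneg_left (hhH j) hR0)))).2
        have h2 := mul_le_mul_of_nonneg_left (hμq _ (hx01 j)) hδ.le
        linarith
      · have h1 : (h j ^ s) ^ 2 * h j = c * Real.log n / (n * μ (x j)) := by
          have h2 : (h j ^ s) ^ 2 * h j = h j ^ (2 * s + 1) := by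
            rw [Real.rpow_add (hh0 j), Real.rpow_one, mul_comm 2 s, Real.rpow_mul (hh0 j).le,
              Real.rpow_two]
          rw [h2, hh, ← Real.rpow_mul (hbase j).le, one_div, inv_mul_cancel₀ hs2.ne',
            Real.rpow_one]
        congr 1
        have h3 := (hμx j).ne'
        rw [mul_assoc (L ^ 2), h1]
        field_simp

/-- An interval of length `ℓ` contains about `ℓ / (2 d)` points at mutual distances `≥ d`. -/
theorem exists_separated_points {I : Set ℝ} (hI : I.OrdConnected)
    (hpos : 0 < volume.real I) {d : ℝ} (hd : 0 < d) :
    ∃ (M : ℕ) (x : Fin M → ℝ), 0 < M ∧ volume.real I / (2 * d) ≤ M ∧ (∀ j, x j ∈ I) ∧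
      ∀ i j, i ≠ j → d ≤ |x i - x j| := by
  set ℓ := volume.real I with hℓ
  -- Half the length is given up because the endpoints need not belong to `I`.
  obtain ⟨y, hy, z, hz, hyz⟩ : ∃ y ∈ I, ∃ z ∈ I, ℓ / 2 ≤ z - y := by
    by_contra! hcon
    have h1 : volume I ≤ ENNReal.ofReal (ℓ / 2) := by
      refine (Real.volume_le_diam I).trans (Metric.ediam_le fun y hy z hz => ?_)
      rw [edist_dist]
      refine ENNReal.ofReal_le_ofReal ?_
      rw [Real.dist_eq, abs_le]
      constructor <;> linarith [hcon y hy z hz, hcon z hz y hy]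
    have h2 : ℓ ≤ ℓ / 2 := by
      have := ENNReal.toReal_mono ENNReal.ofReal_ne_top h1
      rwa [ENNReal.toReal_ofReal (by positivity)] at this
    linarith
  refine ⟨⌊ℓ / (2 * d)⌋₊ + 1, fun j => y + (j : ℕ) * d, Nat.succ_pos _, ?_, fun j => ?_,
    fun i j hij => ?_⟩
  · push_cast
    exact (Nat.lt_floor_add_one _).le
  · refine hI.out hy hz ⟨by simp only [le_add_iff_nonneg_right]; positivity, ?_⟩
    have h1 : ((j : ℕ) : ℝ) ≤ ⌊ℓ / (2 * d)⌋₊ := by exact_mod_cast Nat.lt_succ_iff.1 j.2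
    have h2 : (⌊ℓ / (2 * d)⌋₊ : ℝ) ≤ ℓ / (2 * d) := Nat.floor_le (by positivity)
    have h3 : ((j : ℕ) : ℝ) * d ≤ ℓ / (2 * d) * d :=
      mul_le_mul_of_nonneg_right (h1.trans h2) hd.le
    have h4 : ℓ / (2 * d) * d = ℓ / 2 := by field_simp
    linarith
  · have h1 : (1 : ℝ) ≤ |((i : ℕ) : ℝ) - ((j : ℕ) : ℝ)| := by
      have h2 : ((i : ℕ) : ℤ) - ((j : ℕ) : ℤ) ≠ 0 := by
        intro h
        exact hij (Fin.ext (by omega))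
      have := Int.one_le_abs h2
      exact_mod_cast this
    rw [add_sub_add_left_eq_sub, ← sub_mul, abs_mul, abs_of_pos hd]
    nlinarith

/-! ### Asymptotics -/

theorem minimaxConst_nonneg {s L σ : ℝ} (hs : 0 < s) (hL : 0 < L) (hσ : 0 < σ) :
    0 ≤ minimaxConst s L σ := by
  have := recoveryValue_nonneg hs
  unfold minimaxConst
  positivity

/-- The height of the bumps that carry the information `2 (1 - ε)² log n / (2 s + 1)`. -/
theorem one_sub_mul_minimaxConst_le {s L σ ε r : ℝ} (hs : 0 < s) (hL : 0 < L) (hσ : 0 < σ)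
    (hε1 : ε < 1) (hr : (1 - ε) ^ (1 / (2 * s + 1)) * recoveryValue s ≤ r) :
    (1 - ε) * minimaxConst s L σ ≤
      L * (2 / (2 * s + 1) * (1 - ε) ^ 2 * σ ^ 2 / L ^ 2) ^ (s / (2 * s + 1)) * r := by
  have hs2 : 0 < 2 * s + 1 := by linarith
  have hε : 0 < 1 - ε := by linarith
  set γ := s / (2 * s + 1) with hγ
  set p := 1 / (2 * s + 1) with hp
  have hγp : 2 * γ + p = 1 := by rw [hγ, hp]; field_simp
  have hsq : ∀ y : ℝ, 0 < y → (y ^ 2) ^ γ = y ^ (2 * γ) := fun y hy => by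
    rw [Real.rpow_mul hy.le, Real.rpow_two]
  have hL2 : L / L ^ (2 * γ) = L ^ p := by
    have : p = 1 - 2 * γ := by linarith
    rw [this, Real.rpow_sub hL, Real.rpow_one]
  -- The loss `1 - ε` splits into `(1 - ε) ^ (2 * γ)` from the reduced information and `(1 - ε) ^ p`
  -- from the near-optimality of `φ`.
  have hεε : (1 - ε) ^ (2 * γ) * (1 - ε) ^ p = 1 - ε := by
    rw [← Real.rpow_add hε, hγp, Real.rpow_one]
  have h1 : L * (2 / (2 * s + 1) * (1 - ε) ^ 2 * σ ^ 2 / L ^ 2) ^ γ =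
      (2 / (2 * s + 1)) ^ γ * (1 - ε) ^ (2 * γ) * σ ^ (2 * γ) * L ^ p := by
    rw [Real.div_rpow (by positivity) (by positivity), Real.mul_rpow (by positivity) (by positivity),
      Real.mul_rpow (by positivity) (by positivity), hsq _ hε, hsq _ hσ, hsq _ hL, ← hL2]
    ring
  have h2 : 2 * s / (2 * s + 1) = 2 * γ := by rw [hγ]; ring
  rw [h1, minimaxConst, h2, ← hγ, ← hp]
  calc _ = (2 / (2 * s + 1)) ^ γ * (1 - ε) ^ (2 * γ) * σ ^ (2 * γ) * L ^ p *
        ((1 - ε) ^ p * recoveryValue s) := by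
        conv_lhs => rw [← hεε]
        ring
    _ ≤ _ := by gcongr

theorem tendsto_bandwidth {a p : ℝ} (hp : 0 < p) (q : ℝ) :
    Tendsto (fun n : ℕ => (a * Real.log n / (n * q)) ^ p) atTop (𝓝 0) := by
  have h1 : Tendsto (fun n : ℕ => Real.log n / n) atTop (𝓝 0) :=
    (Real.isLittleO_log_id_atTop.tendsto_div_nhds_zero).comp tendsto_natCast_atTop_atTop
  have h2 : Tendsto (fun n : ℕ => a * Real.log n / (n * q)) atTop (𝓝 0) := by
    have := h1.const_mul (a / q)
    rw [mul_zero] at this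
    refine this.congr fun n => ?_
    rw [div_mul_div_comm, mul_comm q]
  have h3 := h2.rpow_const (p := p) (Or.inr hp.le)
  rwa [Real.zero_rpow hp.ne'] at h3

theorem eventually_log_rpow_le {p e : ℝ} (he : 0 < e) :
    ∀ᶠ n : ℕ in atTop, Real.log n ^ p ≤ (n : ℝ) ^ e := by
  have h := (isLittleO_log_rpow_rpow_atTop p he).bound one_pos
  have h2 := tendsto_natCast_atTop_atTop.eventually h
  filter_upwards [h2, eventually_ge_atTop 1] with n hn hn1
  rw [one_mul] at hn
  have h3 : 0 ≤ (n : ℝ) ^ e := by positivity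
  exact (le_abs_self _).trans (hn.trans (le_of_eq (abs_of_nonneg h3)))

theorem le_liminf_of_le_add_mul {r η : ℕ → ℝ≥0∞} {c : ℝ≥0∞} (hc : c ≠ ⊤)
    (hη : Tendsto η atTop (𝓝 0)) (h : ∀ᶠ n in atTop, c ≤ r n + c * η n) :
    c ≤ liminf r atTop := by
  have h1 : Tendsto (fun n => c - c * η n) atTop (𝓝 c) := by
    have h2 : Tendsto (fun n => c * η n) atTop (𝓝 0) := by
      simpa using ENNReal.Tendsto.const_mul hη (Or.inr hc)
    simpa using ENNReal.Tendsto.sub (tendsto_const_nhds (x := c)) h2 (Or.inl hc)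
  rw [← h1.liminf_eq]
  refine liminf_le_liminf ?_
  filter_upwards [h] with n hn
  exact tsub_le_iff_right.2 hn

theorem tendsto_ofReal_exp_neg {y : ℕ → ℝ} (hy : Tendsto y atTop atTop) :
    Tendsto (fun n => ENNReal.ofReal (Real.exp (-y n))) atTop (𝓝 0) := by
  have := ENNReal.tendsto_ofReal (Real.tendsto_exp_neg_atTop_nhds_zero.comp hy)
  simpa using this

/-- The number of admissible bumps beats their information. -/
theorem card_mul_exp_ge {p ε κ K a ℓ M H b : ℝ} (hK : 0 < K) (ha : 0 < a)
    {n : ℕ} (hn : 1 < n) (hH : H = (a * Real.log n / n) ^ p) (hℓ : 0 ≤ ℓ)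
    (hlog : Real.log n ^ p ≤ (n : ℝ) ^ (p * (1 - ε) - κ)) (hM : ℓ / (2 * (K * H)) ≤ M) :
    Real.exp (-b) / (4 * K * a ^ p) * (ℓ * (n : ℝ) ^ (ε * p)) ≤
      M * Real.exp (-(κ * Real.log n) - b) / 2 := by
  have hn0 : (0 : ℝ) < n := by exact_mod_cast (by omega : 0 < n)
  have hl0 : 0 < Real.log n := Real.log_pos (by exact_mod_cast hn)
  have hap := Real.rpow_pos_of_pos ha p
  have hH0 : 0 < H := by rw [hH]; positivity
  -- The power of `log n` in `H` is absorbed by the polynomial margin `n ^ (p (1 - ε) - κ)`.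
  have hHle : H * (n : ℝ) ^ (ε * p) * (n : ℝ) ^ κ ≤ a ^ p := by
    have h1 : H = a ^ p * Real.log n ^ p * (n : ℝ) ^ (-p) := by
      rw [hH, Real.div_rpow (by positivity) hn0.le, Real.mul_rpow ha.le hl0.le,
        Real.rpow_neg hn0.le, div_eq_mul_inv]
    have h2 : (n : ℝ) ^ (p * (1 - ε) - κ) * (n : ℝ) ^ (-p) * (n : ℝ) ^ (ε * p) * (n : ℝ) ^ κ = 1 := by
      rw [← Real.rpow_add hn0, ← Real.rpow_add hn0, ← Real.rpow_add hn0]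
      ring_nf
      exact Real.rpow_zero _
    calc H * (n : ℝ) ^ (ε * p) * (n : ℝ) ^ κ
        ≤ a ^ p * (n : ℝ) ^ (p * (1 - ε) - κ) * (n : ℝ) ^ (-p) * (n : ℝ) ^ (ε * p) *
            (n : ℝ) ^ κ := by rw [h1]; gcongr
      _ = a ^ p * ((n : ℝ) ^ (p * (1 - ε) - κ) * (n : ℝ) ^ (-p) * (n : ℝ) ^ (ε * p) *
            (n : ℝ) ^ κ) := by ring
      _ = a ^ p := by rw [h2, mul_one]
  have hexp : Real.exp (-(κ * Real.log n) - b) = Real.exp (-b) / (n : ℝ) ^ κ := by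
    rw [Real.rpow_def_of_pos hn0, ← Real.exp_sub]
    ring_nf
  have hnκ := Real.rpow_pos_of_pos hn0 κ
  have hnε := Real.rpow_pos_of_pos hn0 (ε * p)
  calc _ ≤ Real.exp (-b) / (4 * K * (H * (n : ℝ) ^ (ε * p) * (n : ℝ) ^ κ)) *
        (ℓ * (n : ℝ) ^ (ε * p)) := by gcongr
    _ = ℓ / (2 * (K * H)) * (Real.exp (-b) / (n : ℝ) ^ κ) / 2 := by field_simp; ring
    _ ≤ _ := by rw [hexp]; gcongr

theorem ofReal_loss_one_sub_le_liminf {s L Q σ : ℝ} (hs : 0 < s) (hL : 0 < L) (hQ : 0 < Q)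
    (hσ : 0 < σ) {μ : ℝ → ℝ} (hμ : IsDesignDensity μ) (w : ℝ → ℝ) {I : ℕ → Set ℝ}
    (hI : ∀ n, (I n).OrdConnected) (hI01 : ∀ n, I n ⊆ Icc 0 1) {ε : ℝ} (hε : 0 < ε) (hε1 : ε < 1)
    (hlen : Tendsto (fun n : ℕ => volume.real (I n) * (n : ℝ) ^ (ε / (2 * s + 1))) atTop atTop) :
    ENNReal.ofReal (w ((1 - ε) * minimaxConst s L σ)) ≤
      liminf (fun n : ℕ => supMinimaxRisk s L Q σ μ w n (I n)) atTop := by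
  have hs2 : 0 < 2 * s + 1 := by linarith
  have hε' : 0 < 1 - ε := by linarith
  obtain ⟨p, hp⟩ : ∃ p, p = 1 / (2 * s + 1) := ⟨_, rfl⟩
  have hp0 : 0 < p := by rw [hp]; positivity
  obtain ⟨φ, hφ, hφs, hφc, hφ0⟩ := exists_smooth_near_recoveryValue hs
    (δ := 1 - (1 - ε) ^ p) (by linarith [Real.rpow_lt_one hε'.le (by linarith) hp0])
  rw [sub_sub_cancel, hp] at hφ0
  obtain ⟨q, hq, hμq⟩ := hμ.exists_pos_le
  obtain ⟨R, hR0, hR⟩ := exists_support_radius hφc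
  obtain ⟨B, hB⟩ := hφc.exists_bound_of_continuous hφs.continuous
  obtain ⟨K, hK0, hK⟩ := exists_separatesBumps hs hφ.1 hφs hφc
  obtain ⟨δ, hδ, hδ1, hδε⟩ : ∃ δ : ℝ, 0 < δ ∧ δ ≤ 1 ∧ (1 - ε) * (1 + δ) ^ 4 < 1 := by
    -- `15 = 2 ^ 4 - 1`, so `(1 + δ) ^ 4 ≤ 1 + 15 δ = 1 + ε` for `δ ≤ 1`.
    refine ⟨ε / 15, by positivity, by linarith, ?_⟩
    have h1 : (1 + ε / 15) ^ 4 ≤ 1 + ε := by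
      have h2 : ε ^ 2 ≤ ε := by nlinarith
      have h3 : ε ^ 3 ≤ ε := by nlinarith
      have h4 : ε ^ 4 ≤ ε := by nlinarith
      nlinarith
    nlinarith
  obtain ⟨c, hc⟩ : ∃ c, c = 2 / (2 * s + 1) * (1 - ε) ^ 2 * σ ^ 2 / L ^ 2 := ⟨_, rfl⟩
  have hc0 : 0 < c := by rw [hc]; positivity
  obtain ⟨β, hβ⟩ : ∃ β, β = p * (1 - ε) ^ 2 := ⟨_, rfl⟩
  have hβ0 : 0 < β := by rw [hβ]; positivity
  have hcβ : L ^ 2 * c / σ ^ 2 = 2 * β := by rw [hc, hβ, hp]; field_simp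
  -- Four losses of `1 + δ`: the Gaussian test with `lam = δ`, the variation of `μ` over a bump, the
  -- exponential moment of the design, and the excess of the threshold `v` that makes the deviation
  -- term vanish.
  obtain ⟨κ, hκ⟩ : ∃ κ, κ = β * (1 + δ) ^ 4 := ⟨_, rfl⟩
  have he : 0 < p * (1 - ε) - κ := by
    have : p * (1 - ε) - κ = p * (1 - ε) * (1 - (1 - ε) * (1 + δ) ^ 4) := by rw [hκ, hβ]; ring
    rw [this]
    exact mul_pos (mul_pos hp0 hε') (by linarith)
  obtain ⟨H, hH⟩ : ∃ H : ℕ → ℝ, H = fun n : ℕ => (c * Real.log n / (n * q)) ^ (1 / (2 * s + 1)) :=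
    ⟨_, rfl⟩
  have hH0 : Tendsto H atTop (𝓝 0) := hH ▸ tendsto_bandwidth (by positivity) q
  have hHs : Tendsto (fun n => L * H n ^ s * B) atTop (𝓝 0) := by
    have h1 := hH0.rpow_const (p := s) (Or.inr hs.le)
    rw [Real.zero_rpow hs.ne'] at h1
    simpa using (h1.const_mul L).mul_const B
  have hHsq : Tendsto (fun n => (L * H n ^ s * B) ^ 2 / σ ^ 2) atTop (𝓝 0) := by
    simpa using (hHs.pow 2).div_const (σ ^ 2)
  have hHR : Tendsto (fun n => R * H n) atTop (𝓝 0) := by simpa using hH0.const_mul R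
  obtain ⟨ρ, hρ, hρμ⟩ := Metric.uniformContinuousOn_iff.1
    (isCompact_Icc.uniformContinuousOn_of_continuous hμ.continuousOn) (δ * q) (by positivity)
  have hlen' : Tendsto (fun n : ℕ => volume.real (I n) * (n : ℝ) ^ (ε * p)) atTop atTop := by
    refine hlen.congr fun n => ?_
    rw [hp, mul_one_div]
  obtain ⟨C, hC⟩ : ∃ C, C = Real.exp (-(Real.log 2 / δ)) / (4 * K * (c / q) ^ p) := ⟨_, rfl⟩
  have hC0 : 0 < C := by rw [hC]; positivity
  obtain ⟨η, hη⟩ : ∃ η : ℕ → ℝ≥0∞, η = fun n : ℕ =>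
      ENNReal.ofReal (Real.exp (-(C * (volume.real (I n) * (n : ℝ) ^ (ε * p))))) +
        ENNReal.ofReal (Real.exp (-(2 * β * (1 + δ) ^ 2 * δ * Real.log n))) := ⟨_, rfl⟩
  have hη0 : Tendsto η atTop (𝓝 0) := by
    have h1 := tendsto_ofReal_exp_neg (hlen'.const_mul_atTop hC0)
    have h2 := tendsto_ofReal_exp_neg ((Real.tendsto_log_atTop.comp
      tendsto_natCast_atTop_atTop).const_mul_atTop (by positivity : 0 < 2 * β * (1 + δ) ^ 2 * δ))
    simpa [hη] using h1.add h2
  refine le_liminf_of_le_add_mul ENNReal.ofReal_ne_top hη0 ?_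
  filter_upwards [eventually_gt_atTop 1, hHs.eventually_le_const hQ,
    hHsq.eventually_le_const hδ, hHR.eventually_lt_const hρ, hlen'.eventually_gt_atTop 0,
    eventually_log_rpow_le (p := p) he] with n hn hn1 hn2 hn3 hn4 hn5
  have hn0 : (0 : ℝ) < n := by exact_mod_cast (by omega : 0 < n)
  have hlog : 0 < Real.log n := Real.log_pos (by exact_mod_cast hn)
  have hvol : 0 < volume.real (I n) :=
    pos_of_mul_pos_left hn4 (by positivity)
  have hHn : H n = (c * Real.log n / (n * q)) ^ (1 / (2 * s + 1)) := by rw [hH]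
  have hHpos : 0 < H n := by rw [hHn]; positivity
  obtain ⟨M, x, hM0, hM, hx, hsep⟩ := exists_separated_points (hI n) hvol (mul_pos hK0 hHpos)
  have key := ofReal_loss_le_supMinimaxRisk_add_exp (Q := Q) (w := w) hs hL hσ hc0 hq hδ hδ1 hμ
    hμq hφ hφs hR hB hK hn hHn hn1 hn2
    (fun y hy z hz hyz => (hρμ y hy z hz (hyz.trans_lt hn3)).le)
    (mul_nonneg hε'.le (minimaxConst_nonneg hs hL hσ))
    (hc ▸ one_sub_mul_minimaxConst_le hs hL hσ hε1 hφ0) hM0 (hI01 n) hx hsep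
    (2 * β * (1 + δ) ^ 3 * Real.log n)
  refine key.trans ?_
  simp only [hη]
  gcongr
  · have h1 := card_mul_exp_ge (b := Real.log 2 / δ) hK0 (div_pos hc0 hq) hn
      (H := H n) (by rw [hHn, hp]; congr 1; field_simp) hvol.le hn5 hM
    have h2 : (1 + δ) / 2 * (2 * β * (1 + δ) ^ 3 * Real.log n) = κ * Real.log n := by
      rw [hκ]; ring
    rw [h2, hC]
    exact h1
  · rw [hcβ]
    have h3 : (n : ℝ) * ((1 + δ) * (2 * β) * Real.log n / n) = (1 + δ) * (2 * β) * Real.log n := by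
      field_simp
    rw [h3]
    exact le_of_eq (by ring)

theorem theorem2 (s L Q σ : ℝ) (hs : 0 < s) (hL : 0 < L) (hQ : 0 < Q) (hσ : 0 < σ)
    (μ : ℝ → ℝ) (hμ : IsDesignDensity μ) (w : ℝ → ℝ) (hw : IsLoss w)
    (I : ℕ → Set ℝ) (hI : ∀ n, (I n).OrdConnected) (hI01 : ∀ n, I n ⊆ Set.Icc 0 1) :
    (∀ ε : ℝ, 0 < ε → ε < 1 →
      Tendsto (fun n : ℕ => volume.real (I n) * (n : ℝ) ^ (ε / (2 * s + 1))) atTop atTop →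
      ENNReal.ofReal (w ((1 - ε) * minimaxConst s L σ)) ≤
        liminf (fun n : ℕ => supMinimaxRisk s L Q σ μ w n (I n)) atTop) ∧
    ((∀ ε : ℝ, 0 < ε → ε < 1 →
        Tendsto (fun n : ℕ => volume.real (I n) * (n : ℝ) ^ (ε / (2 * s + 1))) atTop atTop) →
      ContinuousWithinAt w (Set.Iic (minimaxConst s L σ)) (minimaxConst s L σ) →
      ENNReal.ofReal (w (minimaxConst s L σ)) ≤
        liminf (fun n : ℕ => supMinimaxRisk s L Q σ μ w n (I n)) atTop) := by
  have hi : ∀ ε : ℝ, 0 < ε → ε < 1 →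
      Tendsto (fun n : ℕ => volume.real (I n) * (n : ℝ) ^ (ε / (2 * s + 1))) atTop atTop →
      ENNReal.ofReal (w ((1 - ε) * minimaxConst s L σ)) ≤
        liminf (fun n : ℕ => supMinimaxRisk s L Q σ μ w n (I n)) atTop := fun ε hε hε1 hlen =>
    ofReal_loss_one_sub_le_liminf hs hL hQ hσ hμ w hI hI01 hε hε1 hlen
  refine ⟨hi, fun hlen hcont => ?_⟩
  have hP := minimaxConst_nonneg hs hL hσ
  set P := minimaxConst s L σ
  -- As `P ≥ 0`, the arguments approach `P` from below, where `w` is continuous; the second part is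
  -- the limit `ε → 0` of the first.
  have h1 : Tendsto (fun ε : ℝ => (1 - ε) * P) (𝓝[>] 0) (𝓝[≤] P) := by
    refine tendsto_nhdsWithin_iff.2 ⟨?_, ?_⟩
    · have : Tendsto (fun ε : ℝ => (1 - ε) * P) (𝓝 0) (𝓝 ((1 - 0) * P)) :=
        Continuous.tendsto (by fun_prop) 0
      rw [sub_zero, one_mul] at this
      exact this.mono_left nhdsWithin_le_nhds
    · filter_upwards [self_mem_nhdsWithin] with ε hε
      have : 0 < ε := hε
      simp only [mem_Iic]
      nlinarith
  have h2 : Tendsto (fun ε : ℝ => ENNReal.ofReal (w ((1 - ε) * P))) (𝓝[>] 0)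
      (𝓝 (ENNReal.ofReal (w P))) := ENNReal.tendsto_ofReal (hcont.tendsto.comp h1)
  refine le_of_tendsto h2 ?_
  filter_upwards [Ioo_mem_nhdsGT (zero_lt_one' ℝ)] with ε hε
  exact hi ε hε.1 hε.2 (hlen ε hε.1 hε.2)
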